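/- \textbf{Setting.} Consider the infinite chain of qubits with sites $\mathbb{Z}$ and its $*$-algebra $\mathfrak{A}$ of local observables. For a pair $\xi=(\xi_X,\xi_Z)$ of Laurent polynomials over $\mathbb{Z}_2$ in $u$ (the coefficient of $u^x$ is denoted $\xi(x)$), let $\mathbf{w}(\xi)=\bigotimes_{x\in\mathbb{Z}}X^{\xi_X(x)}Z^{\xi_Z(x)}$ be the corresponding Pauli product, and let $\tau_x\xi=u^x\xi$ be its translate. A \emph{Clifford quantum cellular automaton} (CQCA) $\mathrm{T}$ is a translation-invariant $*$-automorphism of $\mathfrak{A}$ that maps every Pauli product to a Pauli product times a phase. Its matrix $\mathbf{t}$ is the $2\times2$ matrix of Laurent polynomials over $\mathbb{Z}_2$ whose columns are the labels of the images (up to phase) of the Pauli matrices $X_0=\mathbf{w}(1,0)$ and $Z_0=\mathbf{w}(0,1)$ at the origin. $\mathrm{T}$ is \emph{centered} if all entries of $\mathbf{t}$ are invariant under $u\mapsto u^{-1}$. A state $\omega$ (positive normalized linear functional on $\mathfrak{A}$) is \emph{stabilized} by $S\in\mathfrak A$ if $\omega(SA)=\omega(A)$ for all $A\in\mathfrak{A}$.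 A \emph{pure translation-invariant stabilizer state} is a pure state that is the only state stabilized by a set of the form $\{z\,\mathbf{w}(\tau_x\xi): x\in\mathbb{Z}\}$, for some label $\xi$ and some phase $z$. For a cut of the chain into the half-chains $\{x<c\}$ and $\{x\ge c\}$, the \emph{bipartite entanglement} $E(\omega)$ of a state $\omega$ is the number of maximally entangled qubit pairs, that is, the largest $k$ for which there are hermitian unitary observables $\bar X_i,\bar Z_i$ of the left half-chain and $\bar X_i',\bar Z_i'$ of the right half-chain ($1\le i\le k$), each family satisfying the relations of the Pauli matrices $X,Z$ of $k$ qubits, such that $\omega$ is stabilized by $\bar X_i\bar X_i'$ and $\bar Z_i\bar Z_i'$ for all $i$. If $\omega$ is the initial state, let $E(\omega,t)$ be the bipartite entanglement of the state $\omega\circ\mathrm{T}^{-t}$ after $t$ time steps (this is the state that is stabilized by $\mathrm{T}^t[S]$ for every $S$ that stabilizes $\omega$). \textbf{Theorem.} Let $\mathrm{T}$ be a centered CQCA with matrix $\mathbf{t}$, and let $\omega$ be any pure translation-invariant stabilizer state. Then, for every bipartite cut of the chain, $E(\omega,t)$ is finite for all $t\in\mathbb{N}$, and the asymptotic bipartite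 entanglement generation rate (in maximally entangled qubit pairs per time step) is $$\lim_{t\to\infty}\frac1t\,E(\omega,t)=\deg(\operatorname{tr}\mathbf{t}),$$ where $\deg$ of a Laurent polynomial is its highest exponent of $u$, with $\deg 0=0$. -/

import Mathlib

open scoped ComplexOrder

noncomputable section

namespace CliffordQCA

/-! ### Phase space and Pauli products -/

/-- Laurent polynomials over the field with two elements; the coefficient of `u ^ x` is the entry of
a finitely supported binary string at the lattice site `x`. -/
abbrev Laurent : Type := LaurentPolynomial (ZMod 2)

/-- Phase space: the entry `0` is the string of the Pauli matrices `X`, the entry `1` the string of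
the Pauli matrices `Z`. -/
abbrev PhaseSpace : Type := Fin 2 → Laurent

/-- The scalar product (modulo 2) of two finitely supported binary strings. -/
def dot (f g : Laurent) : ZMod 2 := f.coeff.sum fun x a => a * g.coeff x

/-- The sign `(-1) ^ b`. -/
def sgn (b : ZMod 2) : ℂ := if b = 0 then 1 else -1

/-- The lattice translation by `x` sites on phase space. -/
def shift (x : ℤ) (ξ : PhaseSpace) : PhaseSpace := fun i => LaurentPolynomial.T x * ξ i

/-- The lattice sites on which the Pauli product with label `ξ` differs from the identity. -/
def sites (ξ : PhaseSpace) : Set ℤ := {x | (ξ 0).coeff x ≠ 0 ∨ (ξ 1).coeff x ≠ 0}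

theorem dot_zero_left (g : Laurent) : dot 0 g = 0 := by simp [dot]

theorem dot_zero_right (g : Laurent) : dot g 0 = 0 := by simp [dot]

theorem dot_add_left (f f' g : Laurent) : dot (f + f') g = dot f g + dot f' g := by
  unfold dot
  rw [AddMonoidAlgebra.coeff_add]
  exact Finsupp.sum_add_index' (by simp) (by intros; ring)

theorem dot_add_right (f g g' : Laurent) : dot f (g + g') = dot f g + dot f g' := by
  unfold dot
  rw [AddMonoidAlgebra.coeff_add]
  simp [Finsupp.sum, mul_add, Finset.sum_add_distrib]

theorem dot_comm (f g : Laurent) : dot f g = dot g f := by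
  classical
  unfold dot
  rw [Finsupp.sum_of_support_subset _ (s := f.coeff.support ∪ g.coeff.support)
      Finset.subset_union_left _ (by simp),
    Finsupp.sum_of_support_subset _ (s := f.coeff.support ∪ g.coeff.support)
      Finset.subset_union_right _ (by simp)]
  exact Finset.sum_congr rfl fun x _ => mul_comm _ _

theorem sgn_zero : sgn 0 = 1 := by simp [sgn]

theorem sgn_add (a b : ZMod 2) : sgn (a + b) = sgn a * sgn b := by
  have key : ∀ a b : ZMod 2, (a = 0 ∧ b = 0 ∧ a + b = 0) ∨ (a = 0 ∧ b ≠ 0 ∧ a + b ≠ 0) ∨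
      (a ≠ 0 ∧ b = 0 ∧ a + b ≠ 0) ∨ (a ≠ 0 ∧ b ≠ 0 ∧ a + b = 0) := by decide
  unfold sgn
  rcases key a b with ⟨h1, h2, h3⟩ | ⟨h1, h2, h3⟩ | ⟨h1, h2, h3⟩ | ⟨h1, h2, h3⟩ <;>
    simp [h1, h2, h3]

theorem sgn_mul_self (a : ZMod 2) : sgn a * sgn a = 1 := by
  unfold sgn; split_ifs <;> norm_num

theorem star_sgn (a : ZMod 2) : star (sgn a) = sgn a := by
  unfold sgn; split_ifs <;> simp

/-! ### The algebra of local observables of the spin chain -/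

/-- The algebra of local observables of the infinite chain of qubits (the union over all finite
regions `Λ` of the tensor products `⨂_{x ∈ Λ} M₂(ℂ)`), written in its basis of Pauli products: an
element is a finite complex linear combination of labels of Pauli products. The label `ξ` stands for
`w(ξ) = ⨂ₓ X ^ (ξ 0)(x) * Z ^ (ξ 1)(x)`; the product, the unit and the adjoint of Pauli products are
defined below. -/
def Observable : Type := PhaseSpace →₀ ℂ

namespace Observable

instance : AddCommGroup Observable := inferInstanceAs (AddCommGroup (PhaseSpace →₀ ℂ))
instance : Module ℂ Observable := inferInstanceAs (Module ℂ (PhaseSpace →₀ ℂ))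

/-- The coefficients of an observable in the basis of Pauli products. -/
def coeff (a : Observable) : PhaseSpace →₀ ℂ := a

/-- The Pauli product `w(ξ) = ⨂ₓ X ^ (ξ 0)(x) * Z ^ (ξ 1)(x)`. -/
def weyl (ξ : PhaseSpace) : Observable := Finsupp.single ξ (1 : ℂ)

/-- Multiplication of observables, the bilinear extension of
`w(ξ) * w(η) = (-1) ^ (ξ_Z · η_X) w(ξ + η)`, which at each site is the rule `Z * X = - X * Z` (and
`X ^ 2 = Z ^ 2 = 1`). -/
def mulLin : Observable →ₗ[ℂ] Observable →ₗ[ℂ] Observable :=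
  Finsupp.lsum ℂ fun ξ => LinearMap.toSpanSingleton ℂ (Observable →ₗ[ℂ] Observable)
    (Finsupp.lsum ℂ fun η => LinearMap.toSpanSingleton ℂ Observable
      (sgn (dot (ξ 1) (η 0)) • weyl (ξ + η)))

instance : Mul Observable := ⟨fun a b => mulLin a b⟩
instance : One Observable := ⟨weyl 0⟩

theorem mul_def (a b : Observable) : a * b = mulLin a b := rfl

theorem one_def : (1 : Observable) = weyl 0 := rfl

theorem weyl_mul_weyl (ξ η : PhaseSpace) :
    weyl ξ * weyl η = sgn (dot (ξ 1) (η 0)) • weyl (ξ + η) := by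
  rw [mul_def]
  unfold mulLin
  conv_lhs => rw [weyl, weyl]
  erw [Finsupp.lsum_single, LinearMap.toSpanSingleton_apply, one_smul, Finsupp.lsum_single,
    LinearMap.toSpanSingleton_apply, one_smul]

/-- Linear induction over Pauli products. -/
theorem induction_weyl {p : Observable → Prop} (h0 : p 0) (hadd : ∀ a b, p a → p b → p (a + b))
    (hw : ∀ (z : ℂ) ξ, p (z • weyl ξ)) (a : Observable) : p a := by
  refine Finsupp.induction_linear (motive := p) a h0 hadd fun ξ z => ?_
  have h : z • weyl ξ = (Finsupp.single ξ z : PhaseSpace →₀ ℂ) := Finsupp.smul_single_one ξ z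
  have := hw z ξ
  rw [h] at this
  exact this

theorem smul_mul' (z : ℂ) (a b : Observable) : (z • a) * b = z • (a * b) := by
  simp [mul_def]

theorem mul_smul' (z : ℂ) (a b : Observable) : a * (z • b) = z • (a * b) := by
  simp [mul_def]

theorem add_mul' (a b c : Observable) : (a + b) * c = a * c + b * c := by
  simp [mul_def]

theorem mul_add' (a b c : Observable) : a * (b + c) = a * b + a * c := by
  simp [mul_def]

theorem zero_mul' (a : Observable) : 0 * a = 0 := by simp [mul_def]

theorem mul_zero' (a : Observable) : a * 0 = 0 := by simp [mul_def]

theorem one_mul' (a : Observable) : 1 * a = a := by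
  induction a using induction_weyl with
  | h0 => exact mul_zero' _
  | hadd a b ha hb => rw [mul_add', ha, hb]
  | hw z ξ => rw [mul_smul', one_def, weyl_mul_weyl]; simp [dot_zero_left, sgn_zero]

theorem mul_one' (a : Observable) : a * 1 = a := by
  induction a using induction_weyl with
  | h0 => exact zero_mul' _
  | hadd a b ha hb => rw [add_mul', ha, hb]
  | hw z ξ => rw [smul_mul', one_def, weyl_mul_weyl]; simp [dot_zero_right, sgn_zero]

theorem mul_assoc' (a b c : Observable) : a * b * c = a * (b * c) := by
  induction a using induction_weyl with
  | h0 => simp [zero_mul']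
  | hadd a a' ha ha' => rw [add_mul', add_mul', add_mul', ha, ha']
  | hw z ξ =>
    induction b using induction_weyl with
    | h0 => simp [zero_mul', mul_zero']
    | hadd b b' hb hb' => rw [mul_add', add_mul', add_mul', mul_add', hb, hb']
    | hw z' η =>
      induction c using induction_weyl with
      | h0 => simp [mul_zero']
      | hadd c c' hc hc' => rw [mul_add', mul_add', mul_add', hc, hc']
      | hw z'' ζ =>
        simp only [smul_mul', mul_smul', weyl_mul_weyl, smul_smul, Pi.add_apply, dot_add_left,
          dot_add_right, sgn_add, add_assoc]
        congr 1
        ring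

instance : Ring Observable where
  left_distrib := mul_add'
  right_distrib := add_mul'
  zero_mul := zero_mul'
  mul_zero := mul_zero'
  mul_assoc := mul_assoc'
  one_mul := one_mul'
  mul_one := mul_one'
  neg_add_cancel := neg_add_cancel
  zsmul := fun n a => n • a
  zsmul_zero' := fun a => zero_zsmul a
  zsmul_succ' := fun n a => SubNegMonoid.zsmul_succ' n a
  zsmul_neg' := fun n a => SubNegMonoid.zsmul_neg' n a
  sub_eq_add_neg := sub_eq_add_neg

instance : Algebra ℂ Observable := Algebra.ofModule smul_mul' fun z a b => mul_smul' z a b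

/-- The adjoint, the antilinear extension of `w(ξ)* = (-1) ^ (ξ_X · ξ_Z) w(ξ)`, which at each site is
the rule `(X * Z)* = Z * X = - X * Z`. -/
def adj (a : Observable) : Observable :=
  Finsupp.onFinset (coeff a).support (fun ξ => sgn (dot (ξ 0) (ξ 1)) * star (coeff a ξ)) <| by
    intro ξ h
    rw [Finsupp.mem_support_iff]
    intro h0
    simp [h0] at h

instance : Star Observable := ⟨adj⟩

theorem coeff_star (a : Observable) (ξ : PhaseSpace) :
    coeff (star a) ξ = sgn (dot (ξ 0) (ξ 1)) * star (coeff a ξ) := rfl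

theorem coeff_ext {a b : Observable} (h : ∀ ξ, coeff a ξ = coeff b ξ) : a = b := Finsupp.ext h

theorem coeff_add (a b : Observable) (ξ : PhaseSpace) :
    coeff (a + b) ξ = coeff a ξ + coeff b ξ := rfl

theorem coeff_smul (z : ℂ) (a : Observable) (ξ : PhaseSpace) :
    coeff (z • a) ξ = z * coeff a ξ := rfl

theorem coeff_weyl (ξ η : PhaseSpace) [Decidable (ξ = η)] :
    coeff (weyl ξ) η = if ξ = η then 1 else 0 := by
  exact Finsupp.single_apply (a := ξ) (a' := η) (b := (1 : ℂ))

theorem star_add' (a b : Observable) : star (a + b) = star a + star b := by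
  apply coeff_ext
  intro ξ
  simp only [coeff_star, coeff_add, star_add, mul_add]

theorem star_smul' (z : ℂ) (a : Observable) : star (z • a) = star z • star a := by
  apply coeff_ext
  intro ξ
  simp only [coeff_star, coeff_smul, star_mul']
  ring

theorem star_zero' : star (0 : Observable) = 0 := by
  have := star_smul' 0 0
  simpa using this

theorem star_weyl (ξ : PhaseSpace) : star (weyl ξ) = sgn (dot (ξ 0) (ξ 1)) • weyl ξ := by
  classical
  apply coeff_ext
  intro η
  rw [coeff_star, coeff_smul, coeff_weyl]
  split_ifs with h
  · subst h; simp
  · simp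

theorem star_mul_rev (a b : Observable) : star (a * b) = star b * star a := by
  induction a using induction_weyl with
  | h0 => simp [star_zero']
  | hadd a a' ha ha' => rw [add_mul, star_add', star_add', mul_add, ha, ha']
  | hw z ξ =>
    induction b using induction_weyl with
    | h0 => simp [star_zero']
    | hadd b b' hb hb' => rw [mul_add, star_add', star_add', add_mul, hb, hb']
    | hw z' η =>
      simp only [smul_mul', mul_smul', star_smul', star_weyl, weyl_mul_weyl, smul_smul,
        Pi.add_apply, dot_add_left, dot_add_right, sgn_add, star_mul', star_sgn, add_comm η ξ]
      rw [dot_comm (η 0) (ξ 1), dot_comm (ξ 0) (η 1)]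
      congr 1
      linear_combination (star z * star z' * sgn (dot (ξ 0) (ξ 1)) * sgn (dot (η 0) (η 1)) *
        sgn (dot (η 1) (ξ 0))) * sgn_mul_self (dot (ξ 1) (η 0))

instance : StarRing Observable where
  star_involutive a := by
    apply coeff_ext
    intro ξ
    simp only [coeff_star, star_mul', star_sgn, star_star]
    rw [← mul_assoc, sgn_mul_self, one_mul]
  star_mul := star_mul_rev
  star_add := star_add'

instance : StarModule ℂ Observable := ⟨star_smul'⟩

/-- The lattice translation by `x` sites on observables, `w(ξ) ↦ w(τₓ ξ)`. -/
def translate (x : ℤ) : Observable →ₗ[ℂ] Observable := Finsupp.lmapDomain ℂ ℂ (shift x)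

/-- `a` is an observable of the part `Λ` of the chain: it is a linear combination of Pauli products
that act as the identity at every site outside `Λ`. -/
def LocalizedIn (Λ : Set ℤ) (a : Observable) : Prop := ∀ ξ ∈ (coeff a).support, sites ξ ⊆ Λ

end Observable

open Observable

/-! ### States -/

/-- States: positive normalized linear functionals on the algebra of local observables. -/
structure State where
  /-- The expectation values. -/
  toLin : Observable →ₗ[ℂ] ℂ
  nonneg : ∀ a, 0 ≤ toLin (star a * a)
  map_one : toLin 1 = 1

namespace State

/-- Purity: the state is not a proper convex combination of two other states. -/
def IsPure (ω : State) : Prop :=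
  ∀ (φ ψ : State) (s : ℝ), 0 < s → s < 1 →
    (∀ a, ω.toLin a = (s : ℂ) * φ.toLin a + (1 - (s : ℂ)) * ψ.toLin a) → φ = ω ∧ ψ = ω

/-- `S` stabilizes `ω`, that is, `ω ∘ S = ω`. -/
def Stabilizes (S : Observable) (ω : State) : Prop := ∀ a, ω.toLin (S * a) = ω.toLin a

/-- The translation-invariant set of (phase multiples of) Pauli products generated by `z w(ξ)`. -/
def generators (z : ℂ) (ξ : PhaseSpace) : Set Observable :=
  {S | ∃ x : ℤ, S = z • weyl (shift x ξ)}

/-- Pure translation-invariant stabilizer states: the pure states that are defined by (are the only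
state stabilized by) a translation-invariant set of Pauli products `{z w(τₓ ξ) | x ∈ ℤ}`. -/
def IsPureTIStabilizerState (ω : State) : Prop :=
  ω.IsPure ∧ ∃ (z : ℂ) (ξ : PhaseSpace), ‖z‖ = 1 ∧ (∀ S ∈ generators z ξ, Stabilizes S ω) ∧
    ∀ φ : State, (∀ S ∈ generators z ξ, Stabilizes S φ) → φ = ω

end State

/-! ### Clifford quantum cellular automata -/

/-- A Clifford quantum cellular automaton on the infinite chain of qubits: a translation-invariant
automorphism of the algebra of local observables that maps Pauli products to Pauli products up to a
phase. (As local observables are mapped to local observables and the automorphism is translation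
invariant, the neighborhood of each cell is finite.) -/
structure CQCA where
  /-- The automorphism. -/
  toEquiv : Observable ≃⋆ₐ[ℂ] Observable
  translate_comm : ∀ (x : ℤ) (a : Observable), toEquiv (translate x a) = translate x (toEquiv a)
  clifford : ∀ ξ : PhaseSpace, ∃ (η : PhaseSpace) (z : ℂ), ‖z‖ = 1 ∧ toEquiv (weyl ξ) = z • weyl η

namespace CQCA

/-- The label of the Pauli product to which `w(ξ)` is mapped (up to a phase). -/
def label (T : CQCA) (ξ : PhaseSpace) : PhaseSpace := (T.clifford ξ).choose

theorem label_spec (T : CQCA) (ξ : PhaseSpace) :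
    ∃ z : ℂ, ‖z‖ = 1 ∧ T.toEquiv (weyl ξ) = z • weyl (T.label ξ) := (T.clifford ξ).choose_spec

/-- The label is determined by the automaton. -/
theorem label_unique (T : CQCA) (ξ η : PhaseSpace) (z : ℂ)
    (h : T.toEquiv (weyl ξ) = z • weyl η) : η = T.label ξ := by
  classical
  obtain ⟨z', hz', h'⟩ := T.label_spec ξ
  by_contra hne
  have := congrArg (fun a => coeff a (T.label ξ)) (h.symm.trans h')
  simp only [coeff_smul, coeff_weyl, if_neg hne, if_true, mul_zero, mul_one] at this
  rw [← this] at hz'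
  simp at hz'

/-- The `2 × 2` Laurent polynomial matrix of the automaton. Its columns are the images of the labels
`(1, 0)` of `X₀` and `(0, 1)` of `Z₀`, the Pauli matrices at the origin. -/
def matrix (T : CQCA) : Matrix (Fin 2) (Fin 2) Laurent :=
  Matrix.of fun i j => T.label (Pi.single j 1) i

/-- Centered automata: all matrix entries are reflection invariant (symmetric about the origin). -/
def IsCentered (T : CQCA) : Prop :=
  ∀ i j, LaurentPolynomial.invert (T.matrix i j) = T.matrix i j

/-- One time step of the automaton on states. If `S` stabilizes `ω`, then `T[S]` stabilizes the state
after the step. -/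
def step (T : CQCA) (ω : State) : State where
  toLin := ω.toLin ∘ₗ (T.toEquiv.symm.toAlgEquiv.toLinearMap)
  nonneg a := by
    have h : T.toEquiv.symm (star a * a) = star (T.toEquiv.symm a) * T.toEquiv.symm a := by
      rw [map_mul, map_star]
    change 0 ≤ ω.toLin (T.toEquiv.symm (star a * a))
    rw [h]
    exact ω.nonneg _
  map_one := by
    change ω.toLin (T.toEquiv.symm 1) = 1
    rw [map_one]
    exact ω.map_one

theorem stabilizes_step (T : CQCA) (ω : State) (S : Observable) (h : State.Stabilizes S ω) :
    State.Stabilizes (T.toEquiv S) (T.step ω) := by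
  intro a
  change ω.toLin (T.toEquiv.symm (T.toEquiv S * a)) = ω.toLin (T.toEquiv.symm a)
  rw [map_mul, StarAlgEquiv.symm_apply_apply]
  exact h _

/-- The state after `t` time steps. -/
def evolve (T : CQCA) (t : ℕ) (ω : State) : State := T.step^[t] ω

end CQCA

/-! ### Bipartite entanglement -/

/-- `k` logical qubits encoded in the part `Λ` of the chain, given by their logical Pauli operators:
hermitian unitary observables of `Λ` with the relations of the Pauli matrices of `k` qubits. -/
structure LogicalQubits (Λ : Set ℤ) (k : ℕ) where
  /-- The logical `X` operators. -/
  X : Fin k → Observable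
  /-- The logical `Z` operators. -/
  Z : Fin k → Observable
  localized_X : ∀ i, LocalizedIn Λ (X i)
  localized_Z : ∀ i, LocalizedIn Λ (Z i)
  star_X : ∀ i, star (X i) = X i
  star_Z : ∀ i, star (Z i) = Z i
  sq_X : ∀ i, X i * X i = 1
  sq_Z : ∀ i, Z i * Z i = 1
  anticomm : ∀ i, X i * Z i = -(Z i * X i)
  comm_XX : ∀ i j, X i * X j = X j * X i
  comm_ZZ : ∀ i j, Z i * Z j = Z j * Z i
  comm_XZ : ∀ i j, i ≠ j → X i * Z j = Z j * X i

/-- The `i`-th logical qubits of the two parts form, for each `i`, a maximally entangled pair (the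
Bell state stabilized by `X ⊗ X` and `Z ⊗ Z`). -/
def MaximallyEntangled {A B : Set ℤ} {k : ℕ} (ω : State) (a : LogicalQubits A k)
    (b : LogicalQubits B k) : Prop :=
  ∀ i, State.Stabilizes (a.X i * b.X i) ω ∧ State.Stabilizes (a.Z i * b.Z i) ω

/-- The bipartite entanglement: the (maximal) number of maximally entangled pairs of logical qubits
with respect to the cut of the chain into the half-chains `{x < c}` and `{x ≥ c}`. -/
def entanglement (ω : State) (c : ℤ) : ℕ∞ :=
  sSup {n : ℕ∞ | ∃ k : ℕ, n = k ∧ ∃ (a : LogicalQubits (Set.Iio c) k)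
    (b : LogicalQubits (Set.Ici c) k), MaximallyEntangled ω a b}

/-- The degree of a Laurent polynomial, its highest exponent; the degree of `0` is `0`. -/
def deg (p : Laurent) : ℤ := (LaurentPolynomial.degree p).unbotD 0

end CliffordQCA

end

/-! The proof reduces entanglement to the width of one label and then follows that width in time.

Uniqueness of the state makes the stabilizer labels exactly the multiples `p • ξ` of the generator,
and makes this cyclic module its own symplectic complement (`mem_cyclic_iff`). A label commuting
with all generators would otherwise give a further stabilizer, and a stabilizer outside the module
could have its sign flipped without affecting the generators.

Let the sites of `ξ` extend from `m` to `D`. Then the entanglement across any cut is `(D - m) / 2`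
(`exists_entanglement_eq`). Multiples of `ξ` on one side of the cut `c` contribute nothing; modulo
these, there remain the `p` with exponents in the window `c - D ≤ x < c - m`, a space of dimension
`D - m`. The commutation form of their left halves is nondegenerate by maximality, so a symplectic
basis gives `(D - m) / 2` Bell pairs. Conversely, `k` Bell pairs force Schmidt rank at least `4 ^
k`, while the window permits at most `2 ^ (D - m)`.

The reflection of `ξ` commutes with all translates of `ξ`, hence is a multiple `p • ξ`. A centered
automaton commutes with reflection, so the same `p` serves at all times and the width is `2 * D t +
deg p`: only the right end `D t` has to be followed. Being symplectic and centered, the matrix has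
determinant one, and Cayley-Hamilton gives `ξ (t + 2) = tr • ξ (t + 1) + ξ t`. If the degree `d` of
the trace is positive, the first term eventually dominates and `D t` gains `d` per step; if `d = 0`,
`D t` stays bounded (`exists_abs_sub_le`). -/

noncomputable section

namespace CliffordQCA

/-! ### Supports of Laurent polynomials and labels -/

/-- The exponents occurring in a Laurent polynomial. -/
def supp (p : Laurent) : Set ℤ := {x | p.coeff x ≠ 0}

theorem mem_supp {p : Laurent} {x : ℤ} : x ∈ supp p ↔ p.coeff x ≠ 0 := Iff.rfl

theorem mem_sites {ξ : PhaseSpace} {x : ℤ} : x ∈ sites ξ ↔ ∃ i, x ∈ supp (ξ i) := by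
  simp [sites, mem_supp, Fin.exists_fin_two]

theorem notMem_sites {ξ : PhaseSpace} {x : ℤ} : x ∉ sites ξ ↔ ∀ i, (ξ i).coeff x = 0 := by
  simp [mem_sites, mem_supp]

theorem supp_eq_coe (p : Laurent) : supp p = (p.coeff.support : Set ℤ) := by
  ext; simp [mem_supp]

theorem supp_finite (p : Laurent) : (supp p).Finite := by
  rw [supp_eq_coe]; exact Finset.finite_toSet _

theorem sites_finite (ξ : PhaseSpace) : (sites ξ).Finite :=
  (supp_finite _).union (supp_finite _)

theorem supp_nonempty {p : Laurent} (hp : p ≠ 0) : (supp p).Nonempty := by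
  by_contra h
  rw [Set.not_nonempty_iff_eq_empty, Set.eq_empty_iff_forall_notMem] at h
  exact hp (LaurentPolynomial.ext fun x => by simpa [mem_supp] using h x)

theorem sites_nonempty {ξ : PhaseSpace} (hξ : ξ ≠ 0) : (sites ξ).Nonempty := by
  obtain ⟨i, hi⟩ := Function.ne_iff.mp hξ
  obtain ⟨x, hx⟩ := supp_nonempty hi
  exact ⟨x, mem_sites.mpr ⟨i, hx⟩⟩

theorem exists_isGreatest {s : Set ℤ} (hs : s.Finite) (hne : s.Nonempty) : ∃ e, IsGreatest s e := by
  obtain ⟨a, ha, h⟩ := hs.exists_maximal hne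
  exact ⟨a, ha, fun b hb => (le_total b a).elim id fun hab => h hb hab⟩

theorem exists_isLeast {s : Set ℤ} (hs : s.Finite) (hne : s.Nonempty) : ∃ e, IsLeast s e := by
  obtain ⟨a, ha, h⟩ := hs.exists_minimal hne
  exact ⟨a, ha, fun b hb => (le_total a b).elim id fun hab => h hb hab⟩

theorem exists_add_of_mem_supp_mul {p q : Laurent} {x : ℤ} (h : x ∈ supp (p * q)) :
    ∃ a ∈ supp p, ∃ b ∈ supp q, a + b = x := by
  classical
  by_contra! hne
  apply h
  rw [AddMonoidAlgebra.coeff_mul, Finsupp.sum]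
  refine Finset.sum_eq_zero fun a ha => ?_
  rw [Finsupp.sum]
  refine Finset.sum_eq_zero fun b hb => if_neg ?_
  exact hne a (Finsupp.mem_support_iff.mp ha) b (Finsupp.mem_support_iff.mp hb)

theorem coeff_mul_add_of_upperBounds {p q : Laurent} {a b : ℤ} (ha : a ∈ upperBounds (supp p))
    (hb : b ∈ upperBounds (supp q)) : (p * q).coeff (a + b) = p.coeff a * q.coeff b := by
  apply AddMonoidAlgebra.coeff_mul_add_of_uniqueAdd
  intro x y hx hy h
  have h1 := ha (Finsupp.mem_support_iff.mp hx)
  have h2 := hb (Finsupp.mem_support_iff.mp hy)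
  omega

theorem coeff_mul_add_of_lowerBounds {p q : Laurent} {a b : ℤ} (ha : a ∈ lowerBounds (supp p))
    (hb : b ∈ lowerBounds (supp q)) : (p * q).coeff (a + b) = p.coeff a * q.coeff b := by
  apply AddMonoidAlgebra.coeff_mul_add_of_uniqueAdd
  intro x y hx hy h
  have h1 := ha (Finsupp.mem_support_iff.mp hx)
  have h2 := hb (Finsupp.mem_support_iff.mp hy)
  omega

theorem exists_add_of_mem_sites_smul {p : Laurent} {ξ : PhaseSpace} {x : ℤ}
    (h : x ∈ sites (p • ξ)) : ∃ a ∈ supp p, ∃ b ∈ sites ξ, a + b = x := by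
  obtain ⟨i, hi⟩ := mem_sites.mp h
  obtain ⟨a, ha, b, hb, hab⟩ := exists_add_of_mem_supp_mul hi
  exact ⟨a, ha, b, mem_sites.mpr ⟨i, hb⟩, hab⟩

/-- The coefficients lie in a field, so the product of the two extreme coefficients cannot vanish,
and no other pair of exponents reaches `e + D`. -/
theorem isGreatest_sites_smul {p : Laurent} {ξ : PhaseSpace} {e D : ℤ}
    (he : IsGreatest (supp p) e) (hD : IsGreatest (sites ξ) D) :
    IsGreatest (sites (p • ξ)) (e + D) := by
  constructor
  · obtain ⟨i, hi⟩ := mem_sites.mp hD.1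
    refine mem_sites.mpr ⟨i, ?_⟩
    rw [mem_supp, Pi.smul_apply, smul_eq_mul, coeff_mul_add_of_upperBounds he.2
      fun x hx => hD.2 (mem_sites.mpr ⟨i, hx⟩)]
    exact mul_ne_zero he.1 hi
  · intro x hx
    obtain ⟨a, ha, b, hb, rfl⟩ := exists_add_of_mem_sites_smul hx
    exact add_le_add (he.2 ha) (hD.2 hb)

theorem isLeast_sites_smul {p : Laurent} {ξ : PhaseSpace} {e m : ℤ}
    (he : IsLeast (supp p) e) (hm : IsLeast (sites ξ) m) :
    IsLeast (sites (p • ξ)) (e + m) := by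
  constructor
  · obtain ⟨i, hi⟩ := mem_sites.mp hm.1
    refine mem_sites.mpr ⟨i, ?_⟩
    rw [mem_supp, Pi.smul_apply, smul_eq_mul, coeff_mul_add_of_lowerBounds he.2
      fun x hx => hm.2 (mem_sites.mpr ⟨i, hx⟩)]
    exact mul_ne_zero he.1 hi
  · intro x hx
    obtain ⟨a, ha, b, hb, rfl⟩ := exists_add_of_mem_sites_smul hx
    exact add_le_add (he.2 ha) (hm.2 hb)

theorem supp_zero : supp 0 = ∅ := by ext; simp [mem_supp]

/-- Since the top site of `p • ξ` never cancels, localizing a multiple of `ξ` on one side of the cut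
is purely a condition on the exponents of `p`. -/
theorem sites_smul_subset_Iio_iff {p : Laurent} {ξ : PhaseSpace} {D c : ℤ}
    (hD : IsGreatest (sites ξ) D) : sites (p • ξ) ⊆ Set.Iio c ↔ supp p ⊆ Set.Iio (c - D) := by
  constructor
  · intro h
    rcases eq_or_ne p 0 with rfl | hp
    · simp [supp_zero]
    obtain ⟨e, he⟩ := exists_isGreatest (supp_finite p) (supp_nonempty hp)
    have h1 : e + D < c := h (isGreatest_sites_smul he hD).1
    intro x hx
    have h2 := he.2 hx
    simp only [Set.mem_Iio]
    omega
  · intro h x hx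
    obtain ⟨a, ha, b, hb, rfl⟩ := exists_add_of_mem_sites_smul hx
    have h1 := h ha
    have h2 := hD.2 hb
    simp only [Set.mem_Iio] at *
    omega

theorem sites_smul_subset_Ici_iff {p : Laurent} {ξ : PhaseSpace} {m c : ℤ}
    (hm : IsLeast (sites ξ) m) : sites (p • ξ) ⊆ Set.Ici c ↔ supp p ⊆ Set.Ici (c - m) := by
  constructor
  · intro h
    rcases eq_or_ne p 0 with rfl | hp
    · simp [supp_zero]
    obtain ⟨e, he⟩ := exists_isLeast (supp_finite p) (supp_nonempty hp)
    have h1 : c ≤ e + m := h (isLeast_sites_smul he hm).1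
    intro x hx
    have h2 := he.2 hx
    simp only [Set.mem_Ici]
    omega
  · intro h x hx
    obtain ⟨a, ha, b, hb, rfl⟩ := exists_add_of_mem_sites_smul hx
    have h1 := h ha
    have h2 := hm.2 hb
    simp only [Set.mem_Ici] at *
    omega

theorem isGreatest_sites_add {ξ η : PhaseSpace} {D : ℤ} (hD : IsGreatest (sites ξ) D)
    (h : sites η ⊆ Set.Iio D) : IsGreatest (sites (ξ + η)) D := by
  have key : ∀ i x, (ξ i + η i).coeff x = (ξ i).coeff x + (η i).coeff x := fun i x => by
    rw [AddMonoidAlgebra.coeff_add]; rfl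
  constructor
  · obtain ⟨i, hi⟩ := mem_sites.mp hD.1
    have h0 : (η i).coeff D = 0 := notMem_sites.mp (fun hm => lt_irrefl D (h hm)) i
    refine mem_sites.mpr ⟨i, ?_⟩
    rw [mem_supp, Pi.add_apply, key, h0, add_zero]
    exact hi
  · intro x hx
    by_contra! hlt
    obtain ⟨i, hi⟩ := mem_sites.mp hx
    apply hi
    rw [Pi.add_apply, key, notMem_sites.mp (fun hm => (hD.2 hm).not_gt hlt) i,
      notMem_sites.mp (fun hm => hlt.not_gt (h hm)) i, add_zero]

theorem sites_add_subset {ξ η : PhaseSpace} {s : Set ℤ} (hξ : sites ξ ⊆ s) (hη : sites η ⊆ s) :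
    sites (ξ + η) ⊆ s := by
  intro x hx
  by_contra hxs
  obtain ⟨i, hi⟩ := mem_sites.mp hx
  apply hi
  rw [Pi.add_apply, AddMonoidAlgebra.coeff_add, Finsupp.add_apply,
    notMem_sites.mp (fun h => hxs (hξ h)) i, notMem_sites.mp (fun h => hxs (hη h)) i, add_zero]

/-! ### Reflection -/

/-- The reflection `u ↦ u⁻¹` of labels. -/
def reflect (ξ : PhaseSpace) : PhaseSpace := fun i => LaurentPolynomial.invert (ξ i)

theorem mem_sites_reflect {ξ : PhaseSpace} {x : ℤ} : x ∈ sites (reflect ξ) ↔ -x ∈ sites ξ := by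
  simp [mem_sites, mem_supp, reflect]

theorem isGreatest_sites_reflect {ξ : PhaseSpace} {m : ℤ} (hm : IsLeast (sites ξ) m) :
    IsGreatest (sites (reflect ξ)) (-m) :=
  ⟨mem_sites_reflect.mpr (by simpa using hm.1), fun x hx => by
    have := hm.2 (mem_sites_reflect.mp hx); omega⟩

/-! ### The symplectic form -/

theorem zmod_two_eq (a : ZMod 2) : a = 0 ∨ a = 1 := by revert a; decide

theorem laurent_add_self (p : Laurent) : p + p = 0 := by
  ext x
  rw [AddMonoidAlgebra.coeff_add]
  exact CharTwo.add_self_eq_zero _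

theorem dot_smul_left (a : ZMod 2) (f g : Laurent) : dot (a • f) g = a * dot f g := by
  rcases zmod_two_eq a with rfl | rfl <;> simp [dot_zero_left]

theorem dot_smul_right (a : ZMod 2) (f g : Laurent) : dot f (a • g) = a * dot f g := by
  rw [dot_comm, dot_smul_left, dot_comm]

theorem dot_eq_zero_of_disjoint {f g : Laurent} (h : Disjoint (supp f) (supp g)) :
    dot f g = 0 := by
  refine Finset.sum_eq_zero fun x hx => ?_
  have : g.coeff x = 0 := by
    by_contra hg
    exact Set.disjoint_left.mp h (Finsupp.mem_support_iff.mp hx) hg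
  simp [this]

theorem dot_eq_coeff (f g : Laurent) :
    dot f g = (LaurentPolynomial.invert f * g).coeff 0 := by
  induction f using AddMonoidAlgebra.induction_linear with
  | zero => simp [dot_zero_left]
  | add f f' hf hf' =>
    rw [dot_add_left, hf, hf', map_add, add_mul, AddMonoidAlgebra.coeff_add, Finsupp.add_apply]
  | single x a =>
    have h : (LaurentPolynomial.invert (AddMonoidAlgebra.single x a : Laurent)) =
        AddMonoidAlgebra.single (-x) a := by
      ext y
      simp
    rw [h, dot, AddMonoidAlgebra.coeff_single, Finsupp.sum_single_index (by simp),
      AddMonoidAlgebra.coeff_single_mul_apply]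
    simp

/-- The symplectic form: `w(ξ)` and `w(η)` commute if and only if it vanishes. -/
def symp : PhaseSpace →ₗ[ZMod 2] PhaseSpace →ₗ[ZMod 2] ZMod 2 :=
  LinearMap.mk₂ (ZMod 2) (fun ξ η => dot (ξ 1) (η 0) + dot (ξ 0) (η 1))
    (fun ξ ξ' η => by simp only [Pi.add_apply, dot_add_left]; ring)
    (fun a ξ η => by simp only [Pi.smul_apply, dot_smul_left, smul_eq_mul]; ring)
    (fun ξ η η' => by simp only [Pi.add_apply, dot_add_right]; ring)
    (fun a ξ η => by simp only [Pi.smul_apply, dot_smul_right, smul_eq_mul]; ring)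

theorem symp_apply (ξ η : PhaseSpace) : symp ξ η = dot (ξ 1) (η 0) + dot (ξ 0) (η 1) := rfl

theorem symp_comm (ξ η : PhaseSpace) : symp ξ η = symp η ξ := by
  rw [symp_apply, symp_apply, dot_comm (ξ 1), dot_comm (ξ 0), add_comm]

theorem symp_self (ξ : PhaseSpace) : symp ξ ξ = 0 := by
  rw [symp_apply, dot_comm (ξ 1)]
  exact CharTwo.add_self_eq_zero _

theorem symp_eq_zero_of_disjoint {ξ η : PhaseSpace} (h : Disjoint (sites ξ) (sites η)) :
    symp ξ η = 0 := by
  have key : ∀ i j, dot (ξ i) (η j) = 0 := fun i j =>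
    dot_eq_zero_of_disjoint (h.mono (fun x hx => mem_sites.mpr ⟨i, hx⟩)
      fun x hx => mem_sites.mpr ⟨j, hx⟩)
  rw [symp_apply, key, key, add_zero]

/-- The Laurent polynomial valued symplectic form, which collects the symplectic products with all
translates. -/
def form (ξ η : PhaseSpace) : Laurent :=
  LaurentPolynomial.invert (ξ 1) * η 0 + LaurentPolynomial.invert (ξ 0) * η 1

theorem symp_eq_coeff (ξ η : PhaseSpace) : symp ξ η = (form ξ η).coeff 0 := by
  rw [symp_apply, dot_eq_coeff, dot_eq_coeff, form, AddMonoidAlgebra.coeff_add, Finsupp.add_apply]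

theorem symp_shift_left (x : ℤ) (ξ η : PhaseSpace) :
    symp (shift x ξ) η = (form ξ η).coeff x := by
  have h : form (shift x ξ) η = LaurentPolynomial.T (-x) * form ξ η := by
    simp only [form, shift, map_mul, LaurentPolynomial.invert_T]
    ring
  rw [symp_eq_coeff, h, LaurentPolynomial.T, AddMonoidAlgebra.coeff_single_mul_apply]
  simp

theorem shift_eq_smul (x : ℤ) (ξ : PhaseSpace) :
    shift x ξ = (LaurentPolynomial.T x : Laurent) • ξ := rfl

/-- Reflecting the second argument turns both summands of `form` into the same product of inverted
components, and these cancel in characteristic two. -/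
theorem symp_shift_reflect (x : ℤ) (ξ : PhaseSpace) : symp (shift x ξ) (reflect ξ) = 0 := by
  have h : form ξ (reflect ξ) = 0 := by
    rw [form, reflect, reflect, mul_comm]
    exact laurent_add_self _
  rw [symp_shift_left, h]; rfl

/-- The cyclic submodule generated by a label, as a space of labels. -/
def cyclic (ξ : PhaseSpace) : Submodule (ZMod 2) PhaseSpace :=
  (Submodule.span Laurent {ξ}).restrictScalars (ZMod 2)

theorem mem_cyclic {ξ η : PhaseSpace} : η ∈ cyclic ξ ↔ ∃ p : Laurent, p • ξ = η := by
  simp [cyclic, Submodule.mem_span_singleton]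

theorem shift_mem_cyclic (x : ℤ) (ξ : PhaseSpace) : shift x ξ ∈ cyclic ξ :=
  mem_cyclic.mpr ⟨_, rfl⟩

/-- An additive property of all translates of a label passes to its cyclic submodule. -/
theorem cyclic_le {ξ : PhaseSpace} {N : Submodule (ZMod 2) PhaseSpace}
    (h : ∀ x, shift x ξ ∈ N) : cyclic ξ ≤ N := by
  intro η hη
  obtain ⟨p, rfl⟩ := mem_cyclic.mp hη
  induction p using AddMonoidAlgebra.induction_linear with
  | zero => simp
  | add p q hp hq =>
    rw [add_smul]
    exact N.add_mem (hp (mem_cyclic.mpr ⟨_, rfl⟩)) (hq (mem_cyclic.mpr ⟨_, rfl⟩))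
  | single x a =>
    rcases zmod_two_eq a with rfl | rfl
    · simp
    · exact h x

/-! ### Truncation to a part of the chain -/

open Classical in
/-- The restriction of a label to a part of the chain. -/
def restrict (s : Set ℤ) : PhaseSpace →ₗ[ZMod 2] PhaseSpace where
  toFun ξ i := .ofCoeff ((ξ i).coeff.filter (· ∈ s))
  map_add' ξ η := by
    ext i x
    simp [Finsupp.filter_add]
  map_smul' a ξ := by
    ext i x
    simp [Finsupp.filter_smul]

open Classical in
theorem coeff_restrict (s : Set ℤ) (ξ : PhaseSpace) (i : Fin 2) (x : ℤ) :
    (restrict s ξ i).coeff x = if x ∈ s then (ξ i).coeff x else 0 := by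
  change ((ξ i).coeff.filter (· ∈ s)) x = _
  rw [Finsupp.filter_apply]

theorem sites_restrict_subset (s : Set ℤ) (ξ : PhaseSpace) : sites (restrict s ξ) ⊆ s := by
  intro x hx
  obtain ⟨i, hi⟩ := mem_sites.mp hx
  by_contra h
  exact hi (by rw [coeff_restrict, if_neg h])

theorem restrict_add_restrict_compl (s : Set ℤ) (ξ : PhaseSpace) :
    restrict s ξ + restrict sᶜ ξ = ξ := by
  ext i x
  rw [Pi.add_apply, AddMonoidAlgebra.coeff_add, Finsupp.add_apply, coeff_restrict, coeff_restrict]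
  by_cases h : x ∈ s <;> simp [h]

theorem restrict_eq_self {s : Set ℤ} {ξ : PhaseSpace} (h : sites ξ ⊆ s) : restrict s ξ = ξ := by
  ext i x
  rw [coeff_restrict]
  split_ifs with hx
  · rfl
  · exact (notMem_sites.mp (fun hm => hx (h hm)) i).symm

theorem restrict_eq_zero {s : Set ℤ} {ξ : PhaseSpace} (h : Disjoint (sites ξ) s) :
    restrict s ξ = 0 := by
  ext i x
  rw [coeff_restrict]
  split_ifs with hx
  · exact notMem_sites.mp (fun hm => Set.disjoint_left.mp h hm hx) i
  · rfl

/-- Parts on disjoint regions commute, so there are no cross terms. For commuting labels the two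
pairs of halves therefore commute or anticommute together. -/
theorem symp_eq_add_restrict (s : Set ℤ) (ξ η : PhaseSpace) :
    symp ξ η = symp (restrict s ξ) (restrict s η) + symp (restrict sᶜ ξ) (restrict sᶜ η) := by
  have h1 : symp (restrict s ξ) (restrict sᶜ η) = 0 := symp_eq_zero_of_disjoint
    (disjoint_compl_right.mono (sites_restrict_subset _ _) (sites_restrict_subset _ _))
  have h2 : symp (restrict sᶜ ξ) (restrict s η) = 0 := symp_eq_zero_of_disjoint
    (disjoint_compl_left.mono (sites_restrict_subset _ _) (sites_restrict_subset _ _))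
  conv_lhs => rw [← restrict_add_restrict_compl s ξ, ← restrict_add_restrict_compl s η]
  simp only [map_add, LinearMap.add_apply, h1, h2]
  ring

theorem symp_restrict_left (s : Set ℤ) (ξ η : PhaseSpace) :
    symp (restrict s ξ) η = symp (restrict s ξ) (restrict s η) := by
  have h1 : symp (restrict s ξ) (restrict sᶜ η) = 0 := symp_eq_zero_of_disjoint
    (disjoint_compl_right.mono (sites_restrict_subset _ _) (sites_restrict_subset _ _))
  conv_lhs => rw [← restrict_add_restrict_compl s η]
  rw [map_add, h1, add_zero]

/-! ### Laurent polynomials with exponents in a window -/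

/-- The Laurent polynomials with exponents in `s`. -/
def supportedOn (s : Set ℤ) : Submodule (ZMod 2) Laurent where
  carrier := {p | supp p ⊆ s}
  zero_mem' := by simp [supp_zero]
  add_mem' {p q} hp hq := by
    intro x hx
    by_contra h
    apply hx
    have h1 : p.coeff x = 0 := not_not.mp fun h' => h (hp h')
    have h2 : q.coeff x = 0 := not_not.mp fun h' => h (hq h')
    rw [AddMonoidAlgebra.coeff_add, Finsupp.add_apply, h1, h2, add_zero]
  smul_mem' a p hp := by
    rcases zmod_two_eq a with rfl | rfl
    · simp [supp_zero]
    · simpa using hp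

/-- Laurent polynomials with exponents in `s` are functions on `s`. -/
def supportedOnEquiv (s : Set ℤ) : supportedOn s ≃ₗ[ZMod 2] (s →₀ ZMod 2) :=
  LinearEquiv.trans
    { toFun := fun p => ⟨p.1.coeff, fun _ hx => p.2 (Finsupp.mem_support_iff.mp hx)⟩
      invFun := fun f => ⟨.ofCoeff f.1, fun _ hx => f.2 (Finsupp.mem_support_iff.mpr hx)⟩
      map_add' := fun _ _ => rfl
      map_smul' := fun _ _ => rfl
      left_inv := fun _ => rfl
      right_inv := fun _ => rfl }
    (Finsupp.supportedEquivFinsupp s)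

instance finite_supportedOn_Ico (a b : ℤ) : Module.Finite (ZMod 2) (supportedOn (Set.Ico a b)) :=
  Module.Finite.equiv (supportedOnEquiv _).symm

theorem finrank_supportedOn_Ico (a b : ℤ) :
    Module.finrank (ZMod 2) (supportedOn (Set.Ico a b)) = (b - a).toNat := by
  rw [(supportedOnEquiv _).finrank_eq, Module.finrank_finsupp_self]
  simp

/-! ### Hermitian Pauli products -/

theorem phaseSpace_add_self (ξ : PhaseSpace) : ξ + ξ = 0 := funext fun _ => laurent_add_self _

namespace Observable

theorem coeff_one_zero : coeff 1 0 = 1 := by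
  classical
  rw [one_def, coeff_weyl, if_pos rfl]

theorem smul_one_injective {z z' : ℂ} (h : z • (1 : Observable) = z' • 1) : z = z' := by
  simpa [coeff_smul, coeff_one_zero] using congrArg (fun a => coeff a 0) h

/-- The phase that makes a Pauli product hermitian. -/
def phase (ξ : PhaseSpace) : ℂ := if dot (ξ 0) (ξ 1) = 0 then 1 else Complex.I

theorem phase_mul_self (ξ : PhaseSpace) : phase ξ * phase ξ = sgn (dot (ξ 0) (ξ 1)) := by
  unfold phase sgn; split_ifs <;> simp

theorem phase_ne_zero (ξ : PhaseSpace) : phase ξ ≠ 0 := by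
  unfold phase; split_ifs <;> simp

theorem sgn_mul_star_phase (ξ : PhaseSpace) :
    star (phase ξ) * sgn (dot (ξ 0) (ξ 1)) = phase ξ := by
  unfold phase sgn; split_ifs <;> simp

/-- The hermitian Pauli product with a given label. -/
def pauli (ξ : PhaseSpace) : Observable := phase ξ • weyl ξ

theorem weyl_eq_smul_pauli (ξ : PhaseSpace) : weyl ξ = (phase ξ)⁻¹ • pauli ξ := by
  rw [pauli, smul_smul, inv_mul_cancel₀ (phase_ne_zero ξ), one_smul]

theorem star_pauli (ξ : PhaseSpace) : star (pauli ξ) = pauli ξ := by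
  rw [pauli, star_smul', star_weyl, smul_smul, sgn_mul_star_phase]

theorem pauli_mul_self (ξ : PhaseSpace) : pauli ξ * pauli ξ = 1 := by
  rw [pauli, smul_mul', mul_smul', weyl_mul_weyl, phaseSpace_add_self, smul_smul, smul_smul,
    phase_mul_self, dot_comm, sgn_mul_self, one_smul, one_def]

theorem weyl_comm (ξ η : PhaseSpace) :
    weyl ξ * weyl η = sgn (symp ξ η) • (weyl η * weyl ξ) := by
  rw [weyl_mul_weyl, weyl_mul_weyl, smul_smul, symp_apply, sgn_add, dot_comm (η 1), mul_assoc,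
    sgn_mul_self, mul_one, add_comm]

theorem pauli_comm (ξ η : PhaseSpace) :
    pauli ξ * pauli η = sgn (symp ξ η) • (pauli η * pauli ξ) := by
  simp only [pauli, smul_mul', mul_smul', weyl_comm ξ η, smul_smul]
  congr 1; ring

theorem sgn_one : sgn 1 = -1 := by simp [sgn]

theorem pauli_commute {ξ η : PhaseSpace} (h : symp ξ η = 0) :
    pauli ξ * pauli η = pauli η * pauli ξ := by
  rw [pauli_comm, h, sgn_zero, one_smul]

theorem pauli_anticommute {ξ η : PhaseSpace} (h : symp ξ η = 1) :
    pauli ξ * pauli η = -(pauli η * pauli ξ) := by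
  rw [pauli_comm, h, sgn_one, neg_one_smul]

theorem sgn_ne_zero (a : ZMod 2) : sgn a ≠ 0 := by unfold sgn; split_ifs <;> simp

theorem pauli_mul_pauli (ξ η : PhaseSpace) :
    ∃ z : ℂ, z ≠ 0 ∧ pauli ξ * pauli η = z • pauli (ξ + η) := by
  refine ⟨phase ξ * phase η * sgn (dot (ξ 1) (η 0)) * (phase (ξ + η))⁻¹, ?_, ?_⟩
  · exact mul_ne_zero (mul_ne_zero (mul_ne_zero (phase_ne_zero _) (phase_ne_zero _))
      (sgn_ne_zero _)) (inv_ne_zero (phase_ne_zero _))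
  · rw [← smul_smul, ← weyl_eq_smul_pauli, pauli, pauli, smul_mul', mul_smul', weyl_mul_weyl,
      smul_smul, smul_smul, mul_assoc]

theorem mul_self_eq_one_of_smul_pauli {z : ℂ} {ξ : PhaseSpace}
    (h : (z • pauli ξ) * (z • pauli ξ) = 1) : z * z = 1 := by
  rw [smul_mul', mul_smul', pauli_mul_self, smul_smul] at h
  exact smul_one_injective (h.trans (one_smul ℂ _).symm)

theorem star_eq_self_of_mul_self {z : ℂ} (h : z * z = 1) : star z = z := by
  rcases mul_self_eq_one_iff.mp h with rfl | rfl <;> simp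

/-! ### Localized observables -/

theorem sum_coeff_smul_weyl (a : Observable) :
    ∑ ξ ∈ (coeff a).support, coeff a ξ • weyl ξ = a := by
  have h : ∀ ξ, coeff a ξ • weyl ξ = (Finsupp.single ξ (coeff a ξ) : PhaseSpace →₀ ℂ) :=
    fun ξ => Finsupp.smul_single_one ξ _
  simp only [h]
  exact Finsupp.sum_single (coeff a)

theorem LocalizedIn.induction {s : Set ℤ} {p : Observable → Prop} {a : Observable}
    (ha : LocalizedIn s a) (h0 : p 0) (hadd : ∀ a b, p a → p b → p (a + b))
    (hw : ∀ (z : ℂ) ξ, sites ξ ⊆ s → p (z • weyl ξ)) : p a := by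
  rw [← sum_coeff_smul_weyl a]
  exact Finset.sum_induction _ p hadd h0 fun ξ hξ => hw _ _ (ha ξ hξ)

theorem localizedIn_zero (s : Set ℤ) : LocalizedIn s 0 := fun ξ hξ => by
  exact absurd rfl (Finsupp.mem_support_iff.mp hξ)

theorem LocalizedIn.add {s : Set ℤ} {a b : Observable} (ha : LocalizedIn s a)
    (hb : LocalizedIn s b) : LocalizedIn s (a + b) := fun ξ hξ => by
  by_cases h : coeff a ξ = 0
  · refine hb ξ (Finsupp.mem_support_iff.mpr fun h' => Finsupp.mem_support_iff.mp hξ ?_)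
    rw [coeff_add, h, h', add_zero]
  · exact ha ξ (Finsupp.mem_support_iff.mpr h)

theorem LocalizedIn.smul {s : Set ℤ} {a : Observable} (z : ℂ) (ha : LocalizedIn s a) :
    LocalizedIn s (z • a) := fun ξ hξ =>
  ha ξ (Finsupp.mem_support_iff.mpr fun h' => Finsupp.mem_support_iff.mp hξ (by
    rw [coeff_smul, h', mul_zero]))

theorem localizedIn_weyl {s : Set ℤ} {ξ : PhaseSpace} (h : sites ξ ⊆ s) :
    LocalizedIn s (weyl ξ) := fun η hη => by
  classical
  have := Finsupp.mem_support_iff.mp hη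
  rw [coeff_weyl] at this
  rwa [← of_not_not fun hne => this (if_neg hne)]

theorem localizedIn_pauli {s : Set ℤ} {ξ : PhaseSpace} (h : sites ξ ⊆ s) :
    LocalizedIn s (pauli ξ) := (localizedIn_weyl h).smul _

theorem LocalizedIn.mul {s : Set ℤ} {a b : Observable} (ha : LocalizedIn s a)
    (hb : LocalizedIn s b) : LocalizedIn s (a * b) := by
  refine ha.induction (p := fun a => LocalizedIn s (a * b)) ?_ (fun a a' h h' => ?_)
    fun z ξ hξ => ?_
  · rw [zero_mul]; exact localizedIn_zero s
  · rw [add_mul]; exact h.add h'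
  · rw [smul_mul']
    refine LocalizedIn.smul z (hb.induction (p := fun b => LocalizedIn s (weyl ξ * b)) ?_
      (fun b b' h h' => ?_) fun z' η hη => ?_)
    · rw [mul_zero]; exact localizedIn_zero s
    · rw [mul_add]; exact h.add h'
    · rw [mul_smul', weyl_mul_weyl]
      exact ((localizedIn_weyl (sites_add_subset hξ hη)).smul _).smul _

/-- Observables of disjoint parts of the chain commute. -/
theorem LocalizedIn.mul_comm {s t : Set ℤ} (hst : Disjoint s t) {a b : Observable}
    (ha : LocalizedIn s a) (hb : LocalizedIn t b) : a * b = b * a := by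
  refine ha.induction (p := fun a => a * b = b * a) (by simp)
    (fun a a' h h' => by rw [add_mul, mul_add, h, h'])
    fun z ξ hξ => ?_
  refine hb.induction (p := fun b => (z • weyl ξ) * b = b * (z • weyl ξ)) (by simp)
    (fun a a' h h' => by rw [add_mul, mul_add, h, h'])
    fun z' η hη => ?_
  rw [smul_mul', mul_smul', smul_mul', mul_smul', weyl_comm,
    symp_eq_zero_of_disjoint (hst.mono hξ hη), sgn_zero, one_smul, smul_comm]

/-- The algebra of observables of a part of the chain. -/
def localAlgebra (s : Set ℤ) : Subalgebra ℂ Observable where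
  carrier := {a | LocalizedIn s a}
  mul_mem' := LocalizedIn.mul
  add_mem' := LocalizedIn.add
  algebraMap_mem' z := by
    rw [Algebra.algebraMap_eq_smul_one]
    refine LocalizedIn.smul z (localizedIn_weyl fun x hx => ?_)
    obtain ⟨i, hi⟩ := mem_sites.mp hx
    exact absurd rfl hi

/-! ### Sign flips -/

/-- The linear map that multiplies Pauli products by the signs of a character. -/
def signFlip (χ : PhaseSpace →ₗ[ZMod 2] ZMod 2) : Observable →ₗ[ℂ] Observable :=
  Finsupp.lsum ℂ fun ξ => LinearMap.toSpanSingleton ℂ Observable (sgn (χ ξ) • weyl ξ)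

theorem signFlip_weyl (χ : PhaseSpace →ₗ[ZMod 2] ZMod 2) (ξ : PhaseSpace) :
    signFlip χ (weyl ξ) = sgn (χ ξ) • weyl ξ := by
  unfold signFlip
  conv_lhs => rw [weyl]
  erw [Finsupp.lsum_single, LinearMap.toSpanSingleton_apply, one_smul]

theorem signFlip_mul (χ : PhaseSpace →ₗ[ZMod 2] ZMod 2) (a b : Observable) :
    signFlip χ (a * b) = signFlip χ a * signFlip χ b := by
  induction a using induction_weyl with
  | h0 => simp
  | hadd a a' h h' => rw [add_mul, map_add, map_add, add_mul, h, h']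
  | hw z ξ =>
    induction b using induction_weyl with
    | h0 => simp
    | hadd a a' h h' => rw [mul_add, map_add, map_add, mul_add, h, h']
    | hw z' η =>
      simp only [smul_mul', mul_smul', map_smul, signFlip_weyl, weyl_mul_weyl, smul_smul, map_add,
        sgn_add]
      congr 1; ring

theorem signFlip_star (χ : PhaseSpace →ₗ[ZMod 2] ZMod 2) (a : Observable) :
    signFlip χ (star a) = star (signFlip χ a) := by
  induction a using induction_weyl with
  | h0 => simp
  | hadd a a' h h' => rw [star_add', map_add, map_add, star_add', h, h']
  | hw z ξ =>
    simp only [map_smul, signFlip_weyl, star_smul', star_weyl, smul_smul, star_mul', star_sgn]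
    congr 1; ring

end Observable

namespace State
open Observable

/-! ### Stabilizers of states -/

theorem ext_toLin {ω φ : State} (h : ∀ a, ω.toLin a = φ.toLin a) : ω = φ := by
  cases ω; cases φ
  congr
  exact LinearMap.ext h

/-- Polarization: the expectations of `star b * b` are real for `b = a`, `a + 1` and `a + I • 1`;
the last two compare the imaginary and the real parts respectively. -/
theorem map_star (ω : State) (a : Observable) : ω.toLin (star a) = star (ω.toLin a) := by
  have h0 := (Complex.nonneg_iff.mp (ω.nonneg a)).2
  have h1 := (Complex.nonneg_iff.mp (ω.nonneg (a + 1))).2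
  have h2 := (Complex.nonneg_iff.mp (ω.nonneg (a + Complex.I • 1))).2
  have e1 : star (a + 1) * (a + 1) = star a * a + star a + a + 1 := by
    rw [star_add, star_one]; noncomm_ring
  have e2 : star (a + Complex.I • (1 : Observable)) * (a + Complex.I • 1) =
      star a * a + Complex.I • star a - Complex.I • a + 1 := by
    have hI : Complex.I • Complex.I • (1 : Observable) = -1 := by
      rw [smul_smul, Complex.I_mul_I, neg_one_smul]
    rw [star_add, star_smul, star_one]
    simp only [add_mul, mul_add, smul_mul_assoc, mul_smul_comm, one_mul, mul_one, smul_add,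
      RCLike.star_def, Complex.conj_I, neg_smul, neg_mul, smul_neg, hI]
    abel
  rw [e1] at h1
  rw [e2] at h2
  simp only [map_add, map_sub, map_smul, ω.map_one, Complex.add_im, Complex.sub_im, smul_eq_mul,
    Complex.mul_im, Complex.I_re, Complex.I_im, Complex.one_im] at h1 h2
  apply Complex.ext
  · simp only [RCLike.star_def, Complex.conj_re]; linarith
  · simp only [RCLike.star_def, Complex.conj_im]; linarith

theorem Stabilizes.apply_eq_one {ω : State} {S : Observable} (h : Stabilizes S ω) :
    ω.toLin S = 1 := by
  have := h 1
  rwa [mul_one, ω.map_one] at this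

theorem Stabilizes.mul {ω : State} {S S' : Observable} (h : Stabilizes S ω)
    (h' : Stabilizes S' ω) : Stabilizes (S * S') ω := fun a => by
  rw [mul_assoc, h, h']

theorem stabilizes_one (ω : State) : Stabilizes 1 ω := fun a => by rw [one_mul]

theorem Stabilizes.apply_mul {ω : State} {S : Observable} (h : Stabilizes S ω) (hS : star S = S)
    (a : Observable) : ω.toLin (a * S) = ω.toLin a := by
  rw [← star_star (a * S), star_mul, hS, map_star, h, ← map_star, star_star]

/-- An observable that anticommutes with a hermitian stabilizer has expectation value zero. -/
theorem Stabilizes.apply_eq_zero {ω : State} {S a : Observable} (h : Stabilizes S ω)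
    (hS : star S = S) (ha : S * a = -(a * S)) : ω.toLin a = 0 := by
  have h1 := h a
  rw [ha, map_neg, h.apply_mul hS] at h1
  linear_combination (-1 / 2 : ℂ) * h1

theorem Stabilizes.mul_self_eq_one {ω : State} {z : ℂ} {ξ : PhaseSpace}
    (h : Stabilizes (z • pauli ξ) ω) : z * z = 1 := by
  have := (h.mul h).apply_eq_one
  rwa [smul_mul', mul_smul', pauli_mul_self, smul_smul, map_smul, ω.map_one, smul_eq_mul,
    mul_one] at this

theorem Stabilizes.star_eq {ω : State} {z : ℂ} {ξ : PhaseSpace}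
    (h : Stabilizes (z • pauli ξ) ω) : star (z • pauli ξ) = z • pauli ξ := by
  rw [star_smul', star_pauli, star_eq_self_of_mul_self h.mul_self_eq_one]

/-- The labels of the Pauli products that stabilize a state up to a phase. -/
def stabilizerLabels (ω : State) : Submodule (ZMod 2) PhaseSpace where
  carrier := {η | ∃ z : ℂ, Stabilizes (z • pauli η) ω}
  zero_mem' := by
    refine ⟨(phase 0)⁻¹, ?_⟩
    rw [← weyl_eq_smul_pauli]
    exact stabilizes_one ω
  add_mem' {η ζ} := by
    rintro ⟨z, hz⟩ ⟨z', hz'⟩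
    obtain ⟨y, -, hy⟩ := pauli_mul_pauli η ζ
    refine ⟨z * z' * y, ?_⟩
    have := hz.mul hz'
    rwa [smul_mul', mul_smul', hy, smul_smul, smul_smul] at this
  smul_mem' a η hη := by
    rcases zmod_two_eq a with rfl | rfl
    · rw [zero_smul]
      refine ⟨(phase 0)⁻¹, ?_⟩
      rw [← weyl_eq_smul_pauli]
      exact stabilizes_one ω
    · rwa [one_smul]

/-- Both products of two stabilizers have expectation one, whereas anticommutation would make these
expectations opposite. -/
theorem symp_eq_zero_of_mem_stabilizerLabels {ω : State} {η ζ : PhaseSpace}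
    (hη : η ∈ stabilizerLabels ω) (hζ : ζ ∈ stabilizerLabels ω) : symp η ζ = 0 := by
  obtain ⟨z, hz⟩ := hη
  obtain ⟨z', hz'⟩ := hζ
  refine (zmod_two_eq _).resolve_right fun h1 => ?_
  have h2 := (hz.mul hz').apply_eq_one
  have h3 := (hz'.mul hz).apply_eq_one
  rw [smul_mul', mul_smul', pauli_anticommute h1, smul_neg, smul_neg, map_neg, smul_comm] at h2
  rw [smul_mul', mul_smul'] at h3
  rw [h3] at h2
  norm_num at h2

/-- The state conditioned on the outcome described by an observable. -/
def compress (ω : State) (B : Observable) (hB : ω.toLin (star B * B) ≠ 0) : State where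
  toLin := (ω.toLin (star B * B))⁻¹ •
    (ω.toLin ∘ₗ LinearMap.mulLeft ℂ (star B) ∘ₗ LinearMap.mulRight ℂ B)
  nonneg a := by
    have h : star B * (star a * a * B) = star (a * B) * (a * B) := by
      rw [star_mul]; noncomm_ring
    change 0 ≤ (ω.toLin (star B * B))⁻¹ * ω.toLin (star B * (star a * a * B))
    rw [h]
    refine mul_nonneg ?_ (ω.nonneg _)
    obtain ⟨h1, h2⟩ := Complex.nonneg_iff.mp (ω.nonneg B)
    have h3 : ω.toLin (star B * B) = ((ω.toLin (star B * B)).re : ℂ) :=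
      Complex.ext rfl (by simpa using h2.symm)
    rw [h3, ← Complex.ofReal_inv]
    exact Complex.zero_le_real.mpr (inv_nonneg.mpr h1)
  map_one := by
    change (ω.toLin (star B * B))⁻¹ * ω.toLin (star B * (1 * B)) = 1
    rw [one_mul, inv_mul_cancel₀ hB]

theorem compress_apply (ω : State) (B : Observable) (hB : ω.toLin (star B * B) ≠ 0)
    (a : Observable) : (ω.compress B hB).toLin a =
      (ω.toLin (star B * B))⁻¹ * ω.toLin (star B * (a * B)) := rfl

/-- The state with expectation values of Pauli products multiplied by the signs of a character. -/
def flip (ω : State) (χ : PhaseSpace →ₗ[ZMod 2] ZMod 2) : State where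
  toLin := ω.toLin ∘ₗ signFlip χ
  nonneg a := by
    change 0 ≤ ω.toLin (signFlip χ (star a * a))
    rw [signFlip_mul, signFlip_star]
    exact ω.nonneg _
  map_one := by
    change ω.toLin (signFlip χ 1) = 1
    rw [one_def, signFlip_weyl, map_zero, sgn_zero, one_smul, ← one_def, ω.map_one]

/-- The state is the only one stabilized by the translates of `z w(ξ)`. -/
def IsDefinedBy (ω : State) (z : ℂ) (ξ : PhaseSpace) : Prop :=
  (∀ S ∈ generators z ξ, Stabilizes S ω) ∧
    ∀ φ : State, (∀ S ∈ generators z ξ, Stabilizes S φ) → φ = ω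

namespace IsDefinedBy

variable {ω : State} {z : ℂ} {ξ : PhaseSpace}

theorem cyclic_le_stabilizerLabels (h : ω.IsDefinedBy z ξ) : cyclic ξ ≤ stabilizerLabels ω :=
  cyclic_le fun x => ⟨z * (phase (shift x ξ))⁻¹, by
    rw [← smul_smul, ← weyl_eq_smul_pauli]
    exact h.1 _ ⟨x, rfl⟩⟩

/-- Otherwise a sign flip yields another state with the same stabilizer generators. -/
theorem stabilizerLabels_le (h : ω.IsDefinedBy z ξ) : stabilizerLabels ω ≤ cyclic ξ := by
  intro η hη
  by_contra hne
  obtain ⟨χ, hχη, hχ⟩ := Submodule.exists_le_ker_of_notMem hne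
  obtain ⟨y, hy⟩ := hη
  have hflip : ω.flip χ = ω := h.2 _ fun S hS a => by
    obtain ⟨x, rfl⟩ := hS
    have hx : χ (shift x ξ) = 0 := hχ (shift_mem_cyclic x ξ)
    change ω.toLin (signFlip χ _) = ω.toLin (signFlip χ a)
    rw [signFlip_mul, map_smul, signFlip_weyl, hx, sgn_zero, one_smul]
    exact h.1 _ ⟨x, rfl⟩ _
  have h1 := hy.apply_eq_one
  have h2 : ω.toLin (signFlip χ (y • pauli η)) = 1 := by
    have : (ω.flip χ).toLin (y • pauli η) = 1 := by rw [hflip, h1]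
    exact this
  have h3 : signFlip χ (y • pauli η) = -(y • pauli η) := by
    rw [pauli, map_smul, map_smul, signFlip_weyl, (zmod_two_eq _).resolve_left hχη, sgn_one,
      neg_one_smul, smul_neg, smul_neg]
  rw [h3, map_neg, h1] at h2
  norm_num at h2

/-- A hermitian unitary that commutes with the stabilizer generators and whose outcome `1` has
nonzero probability stabilizes the state. -/
theorem stabilizes_of_commute (h : ω.IsDefinedBy z ξ) {U : Observable} (hU : star U = U)
    (hUU : U * U = 1) (hcomm : ∀ S ∈ generators z ξ, S * U = U * S)
    (hne : ω.toLin U ≠ -1) : Stabilizes U ω := by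
  -- `1 + U` is twice the projection onto the outcome `1`; the factor disappears in the
  -- normalization of `compress`.
  have hB : star (1 + U) = 1 + U := by rw [star_add, star_one, hU]
  have hBU : (1 + U) * U = 1 + U := by rw [add_mul, one_mul, hUU, add_comm]
  have hsq : ω.toLin (star (1 + U) * (1 + U)) ≠ 0 := by
    rw [hB, mul_add, mul_one, hBU, map_add, map_add, ω.map_one]
    intro h0
    exact hne (by linear_combination (1 / 2 : ℂ) * h0)
  -- The conditioned state still has all the generators as stabilizers, so uniqueness identifies it
  -- with `ω`; and it absorbs `U` because `(1 + U) * U = 1 + U`.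
  have hφ : ω.compress (1 + U) hsq = ω := h.2 _ fun S hS a => by
    have hS' : (1 + U) * S = S * (1 + U) := by rw [add_mul, mul_add, hcomm S hS, one_mul, mul_one]
    rw [compress_apply, compress_apply, hB, mul_assoc, ← mul_assoc, hS', mul_assoc, h.1 S hS]
  intro a
  rw [← hφ, compress_apply, compress_apply, hB, mul_assoc, ← mul_assoc, hBU]

/-- At least one of the outcomes `1` and `-1` of the Pauli product has nonzero probability; that
sign is the one that stabilizes. -/
theorem mem_stabilizerLabels_of_symp (h : ω.IsDefinedBy z ξ) {η : PhaseSpace}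
    (hη : ∀ x, symp (shift x ξ) η = 0) : η ∈ stabilizerLabels ω := by
  have hcomm : ∀ S ∈ generators z ξ, S * pauli η = pauli η * S := by
    rintro S ⟨x, rfl⟩
    rw [weyl_eq_smul_pauli]
    simp only [smul_mul', mul_smul', pauli_commute (hη x)]
  by_cases hne : ω.toLin (pauli η) = -1
  · refine ⟨-1, h.stabilizes_of_commute ?_ ?_ (fun S hS => ?_) ?_⟩
    · rw [neg_one_smul, star_neg, star_pauli]
    · rw [neg_one_smul, neg_mul_neg, pauli_mul_self]
    · rw [neg_one_smul, mul_neg, neg_mul, hcomm S hS]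
    · rw [neg_one_smul, map_neg, hne]; norm_num
  · refine ⟨1, ?_⟩
    rw [one_smul]
    exact h.stabilizes_of_commute (star_pauli η) (pauli_mul_self η) hcomm hne

/-- Maximal isotropy of the stabilizer module, the algebraic content of the uniqueness of the state.
-/
theorem mem_cyclic_iff (h : ω.IsDefinedBy z ξ) {η : PhaseSpace} :
    η ∈ cyclic ξ ↔ ∀ x, symp (shift x ξ) η = 0 :=
  ⟨fun hη x => symp_eq_zero_of_mem_stabilizerLabels
    (h.cyclic_le_stabilizerLabels (shift_mem_cyclic x ξ)) (h.cyclic_le_stabilizerLabels hη),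
    fun hη => h.stabilizerLabels_le (h.mem_stabilizerLabels_of_symp hη)⟩

theorem symp_eq_zero (h : ω.IsDefinedBy z ξ) {η ζ : PhaseSpace} (hη : η ∈ cyclic ξ)
    (hζ : ζ ∈ cyclic ξ) : symp η ζ = 0 :=
  symp_eq_zero_of_mem_stabilizerLabels (h.cyclic_le_stabilizerLabels hη)
    (h.cyclic_le_stabilizerLabels hζ)

/-- By maximality such a Pauli product anticommutes with some stabilizer. -/
theorem apply_pauli_eq_zero (h : ω.IsDefinedBy z ξ) {η : PhaseSpace} (hη : η ∉ cyclic ξ) :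
    ω.toLin (pauli η) = 0 := by
  rw [h.mem_cyclic_iff] at hη
  push Not at hη
  obtain ⟨x, hx⟩ := hη
  obtain ⟨y, hy⟩ := h.cyclic_le_stabilizerLabels (shift_mem_cyclic x ξ)
  refine hy.apply_eq_zero hy.star_eq ?_
  rw [smul_mul', mul_smul', pauli_anticommute ((zmod_two_eq _).resolve_left hx), smul_neg]

/-- The resulting multiplier `p` with `p • ξ = reflect ξ` ties the left end of the label to its
right end. -/
theorem reflect_mem_cyclic (h : ω.IsDefinedBy z ξ) : reflect ξ ∈ cyclic ξ :=
  h.mem_cyclic_iff.mpr fun x => symp_shift_reflect x ξ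

/-- The complement of the zero module is everything, so the zero module is not maximal isotropic. -/
theorem label_ne_zero (h : ω.IsDefinedBy z ξ) : ξ ≠ 0 := by
  rintro rfl
  have h1 : ∀ η : PhaseSpace, η ∈ cyclic 0 := fun η => h.mem_cyclic_iff.mpr fun x => by
    rw [shift_eq_smul, smul_zero, map_zero, LinearMap.zero_apply]
  obtain ⟨p, hp⟩ := mem_cyclic.mp (h1 1)
  rw [smul_zero] at hp
  exact zero_ne_one (congrFun hp 0)

end IsDefinedBy

end State

/-! ### Linear algebra -/

/-- A nonzero space on which the Pauli matrices of `n` qubits act has dimension at least `2 ^ n`. -/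
theorem two_pow_card_le_finrank {E ι : Type*} [AddCommGroup E] [Module ℂ E]
    {P Q : ι → Module.End ℂ E} (hP : ∀ i, P i * P i = 1) (hQ : ∀ i, Q i * Q i = 1)
    (hPQ : ∀ i, P i * Q i = -(Q i * P i)) (hPP : ∀ i j, i ≠ j → P i * P j = P j * P i)
    (hcomm : ∀ i j, i ≠ j → P i * Q j = Q j * P i) (s : Finset ι) :
    ∀ (V : Submodule ℂ E) [FiniteDimensional ℂ V], V ≠ ⊥ →
      (∀ i ∈ s, ∀ v ∈ V, P i v ∈ V ∧ Q i v ∈ V) → 2 ^ s.card ≤ Module.finrank ℂ V := by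
  classical
  induction s using Finset.induction_on with
  | empty =>
    intro V _ hV _
    rw [Finset.card_empty, pow_zero, Nat.one_le_iff_ne_zero, ne_eq, Submodule.finrank_eq_zero]
    exact hV
  | insert i s hi ih =>
    intro V _ hV hinv
    have hPi := hinv i (Finset.mem_insert_self i s)
    have aPP : ∀ v, P i (P i v) = v := fun v => LinearMap.congr_fun (hP i) v
    have aQQ : ∀ v, Q i (Q i v) = v := fun v => LinearMap.congr_fun (hQ i) v
    have aPQ : ∀ v, P i (Q i v) = -Q i (P i v) := fun v => LinearMap.congr_fun (hPQ i) v
    -- `V` contains both eigenspaces of `P i`, which `Q i` interchanges; the remaining operators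
    -- commute with `P i` and act on the `+1` eigenspace, so each index doubles the dimension.
    let Vp : Submodule ℂ E := V ⊓ LinearMap.ker (P i - 1)
    let Vm : Submodule ℂ E := V ⊓ LinearMap.ker (P i + 1)
    have mem_p : ∀ v, v ∈ Vp ↔ v ∈ V ∧ P i v = v := fun v => by
      simp [Vp, sub_eq_zero]
    have mem_m : ∀ v, v ∈ Vm ↔ v ∈ V ∧ P i v = -v := fun v => by
      simp [Vm, add_eq_zero_iff_eq_neg]
    have : FiniteDimensional ℂ Vp := Submodule.finiteDimensional_of_le inf_le_left
    have : FiniteDimensional ℂ Vm := Submodule.finiteDimensional_of_le inf_le_left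
    have hVp : Vp ≠ ⊥ := by
      obtain ⟨v, hv, hv0⟩ := Submodule.exists_mem_ne_zero_of_ne_bot hV
      rw [Submodule.ne_bot_iff]
      by_cases h : P i v = -v
      · refine ⟨Q i v, (mem_p _).mpr ⟨(hPi v hv).2, ?_⟩, fun h0 => hv0 ?_⟩
        · rw [aPQ, h, map_neg, neg_neg]
        · rw [← aQQ v, h0, map_zero]
      · refine ⟨P i v + v, (mem_p _).mpr ⟨V.add_mem (hPi v hv).1 hv, ?_⟩, fun h0 => h ?_⟩
        · rw [map_add, aPP, add_comm]
        · exact eq_neg_of_add_eq_zero_left h0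
    have h1 : 2 ^ s.card ≤ Module.finrank ℂ Vp := by
      refine ih Vp hVp fun j hj v hv => ?_
      have hij : i ≠ j := fun h => hi (h ▸ hj)
      obtain ⟨hv1, hv2⟩ := (mem_p v).mp hv
      have hj' := hinv j (Finset.mem_insert_of_mem hj) v hv1
      have e1 : P i (P j v) = P j (P i v) := LinearMap.congr_fun (hPP i j hij) v
      have e2 : P i (Q j v) = Q j (P i v) := LinearMap.congr_fun (hcomm i j hij) v
      exact ⟨(mem_p _).mpr ⟨hj'.1, by rw [e1, hv2]⟩, (mem_p _).mpr ⟨hj'.2, by rw [e2, hv2]⟩⟩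
    have hinj : Function.Injective (Q i) := Function.LeftInverse.injective aQQ
    have h2 : Module.finrank ℂ Vp ≤ Module.finrank ℂ Vm := by
      rw [(Submodule.equivMapOfInjective (Q i) hinj Vp).finrank_eq]
      refine Submodule.finrank_mono ?_
      rintro _ ⟨v, hv, rfl⟩
      obtain ⟨hv1, hv2⟩ := (mem_p v).mp hv
      exact (mem_m _).mpr ⟨(hPi v hv1).2, by rw [aPQ, hv2]⟩
    have h3 : Vp ⊓ Vm = ⊥ := by
      rw [eq_bot_iff]
      rintro v ⟨hv, hv'⟩
      have h4 := ((mem_p v).mp hv).2.symm.trans ((mem_m v).mp hv').2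
      have h5 : (2 : ℂ) • v = 0 := by rw [two_smul]; exact eq_neg_iff_add_eq_zero.mp h4
      exact (smul_eq_zero.mp h5).resolve_left two_ne_zero
    have h4 := Submodule.finrank_sup_add_finrank_inf_eq Vp Vm
    rw [h3, finrank_bot, add_zero] at h4
    have h5 : Module.finrank ℂ ↥(Vp ⊔ Vm) ≤ Module.finrank ℂ V :=
      Submodule.finrank_mono (sup_le inf_le_left inf_le_left)
    rw [Finset.card_insert_of_notMem hi, pow_succ]
    omega

/-- A finite-dimensional space with a nondegenerate alternating form has a symplectic basis. -/
theorem exists_hyperbolic_pairs {V : Type*} [AddCommGroup V] [Module (ZMod 2) V]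
    (B : V →ₗ[ZMod 2] V →ₗ[ZMod 2] ZMod 2) (halt : ∀ v, B v v = 0)
    (hsymm : ∀ v w, B v w = B w v) (n : ℕ) :
    ∀ (W : Submodule (ZMod 2) V) [FiniteDimensional (ZMod 2) W], Module.finrank (ZMod 2) W ≤ n →
      (∀ w ∈ W, (∀ w' ∈ W, B w w' = 0) → w = 0) →
      ∃ (k : ℕ) (e f : Fin k → V), Module.finrank (ZMod 2) W ≤ 2 * k ∧ (∀ i, e i ∈ W ∧ f i ∈ W) ∧
        (∀ i j, B (e i) (e j) = 0) ∧ (∀ i j, B (f i) (f j) = 0) ∧ (∀ i, B (e i) (f i) = 1) ∧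
        ∀ i j, i ≠ j → B (e i) (f j) = 0 := by
  induction n with
  | zero =>
    intro W _ hn _
    exact ⟨0, Fin.elim0, Fin.elim0, by omega, fun i => i.elim0, fun i => i.elim0,
      fun i => i.elim0, fun i => i.elim0, fun i => i.elim0⟩
  | succ n ih =>
    intro W _ hn hnd
    by_cases hW : W = ⊥
    · subst hW
      exact ⟨0, Fin.elim0, Fin.elim0, by simp, fun i => i.elim0, fun i => i.elim0,
        fun i => i.elim0, fun i => i.elim0, fun i => i.elim0⟩
    obtain ⟨w, hw, hw0⟩ := Submodule.exists_mem_ne_zero_of_ne_bot hW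
    obtain ⟨w', hw', h1⟩ : ∃ w' ∈ W, B w w' ≠ 0 := by
      by_contra! h
      exact hw0 (hnd w hw h)
    replace h1 := (zmod_two_eq _).resolve_left h1
    -- The complement in `W` of the hyperbolic plane spanned by `w` and `w'`; `hproj` is the
    -- projection onto it.
    let U : Submodule (ZMod 2) V := W ⊓ (LinearMap.ker (B w) ⊓ LinearMap.ker (B w'))
    have mem_U : ∀ v, v ∈ U ↔ v ∈ W ∧ B w v = 0 ∧ B w' v = 0 := fun v => by simp [U]
    have : FiniteDimensional (ZMod 2) U := Submodule.finiteDimensional_of_le inf_le_left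
    have hproj : ∀ v ∈ W, v + (B w' v • w + B w v • w') ∈ U := fun v hv => by
      refine (mem_U _).mpr ⟨W.add_mem hv (W.add_mem (W.smul_mem _ hw) (W.smul_mem _ hw')), ?_, ?_⟩
      · simp only [map_add, map_smul, halt, h1, smul_eq_mul, mul_zero, mul_one, zero_add]
        exact CharTwo.add_self_eq_zero _
      · simp only [map_add, map_smul, halt, hsymm w' w, h1, smul_eq_mul, mul_zero, mul_one,
          add_zero]
        exact CharTwo.add_self_eq_zero _
    have hdim : Module.finrank (ZMod 2) W ≤ Module.finrank (ZMod 2) U + 2 := by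
      have hle : W ≤ U ⊔ Submodule.span (ZMod 2) {w, w'} := fun v hv => by
        have hs : B w' v • w + B w v • w' ∈ Submodule.span (ZMod 2) {w, w'} :=
          Submodule.mem_span_pair.mpr ⟨_, _, rfl⟩
        have := Submodule.sub_mem_sup (hproj v hv) hs
        rwa [add_sub_cancel_right] at this
      have : FiniteDimensional (ZMod 2) (Submodule.span (ZMod 2) {w, w'}) :=
        FiniteDimensional.span_of_finite _ (Set.toFinite _)
      have hspan : Module.finrank (ZMod 2) (Submodule.span (ZMod 2) {w, w'}) ≤ 2 := by
        classical
        refine (finrank_span_le_card _).trans ?_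
        simpa using Finset.card_le_two (a := w) (b := w')
      exact (Submodule.finrank_mono hle).trans
        ((Submodule.finrank_add_le_finrank_add_finrank _ _).trans (by omega))
    have hwU : w ∉ U := fun h => by
      have := ((mem_U w).mp h).2.2
      rw [hsymm, h1] at this
      exact one_ne_zero this
    have hlt : Module.finrank (ZMod 2) U < Module.finrank (ZMod 2) W :=
      Submodule.finrank_lt_finrank_of_lt (lt_of_le_of_ne inf_le_left fun h => hwU (h ▸ hw))
    -- Nondegeneracy is inherited: `v` in `U` pairs with any `y` in `W` as it does with the
    -- projection of `y` to `U`.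
    obtain ⟨k, e, f, hk, hmem, hee, hff, hef, hne⟩ := ih U (by omega) fun v hv hv0 => by
      obtain ⟨hvW, hv1, hv2⟩ := (mem_U v).mp hv
      refine hnd v hvW fun y hy => ?_
      have := hv0 _ (hproj y hy)
      simpa [hsymm v w, hsymm v w', hv1, hv2] using this
    have he := fun i => (mem_U _).mp (hmem i).1
    have hf := fun i => (mem_U _).mp (hmem i).2
    refine ⟨k + 1, Fin.cons w e, Fin.cons w' f, by omega, ?_, ?_, ?_, ?_, ?_⟩
    · exact Fin.cases ⟨hw, hw'⟩ fun i => ⟨(he i).1, (hf i).1⟩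
    · refine Fin.cases (Fin.cases (halt w) fun j => (he j).2.1) fun i => Fin.cases ?_ fun j => hee i j
      simp only [Fin.cons_succ, Fin.cons_zero]
      rw [hsymm]; exact (he i).2.1
    · refine Fin.cases (Fin.cases (halt w') fun j => (hf j).2.2) fun i => Fin.cases ?_ fun j => hff i j
      simp only [Fin.cons_succ, Fin.cons_zero]
      rw [hsymm]; exact (hf i).2.2
    · exact Fin.cases h1 fun i => hef i
    · refine Fin.cases (Fin.cases (fun h => absurd rfl h) fun j _ => (hf j).2.1) fun i =>
        Fin.cases (fun _ => ?_) fun j h => hne i j fun hij => h (hij ▸ rfl)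
      simp only [Fin.cons_succ, Fin.cons_zero]
      rw [hsymm]; exact (he i).2.2

open Observable State

/-! ### Entanglement of stabilizer states: upper bound -/

theorem supportedOn_mono {s t : Set ℤ} (h : s ⊆ t) : supportedOn s ≤ supportedOn t :=
  fun _ hp => hp.trans h

theorem exists_supportedOn_add (s : Set ℤ) (p : Laurent) :
    ∃ q ∈ supportedOn s, ∃ r ∈ supportedOn sᶜ, p = q + r := by
  -- `restrict` acts on labels, so `p` is used as both components and the entry `0` is read off.
  refine ⟨restrict s (fun _ => p) 0, fun x hx => ?_, restrict sᶜ (fun _ => p) 0, fun x hx => ?_, ?_⟩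
  · exact sites_restrict_subset _ _ (mem_sites.mpr ⟨0, hx⟩)
  · exact sites_restrict_subset _ _ (mem_sites.mpr ⟨0, hx⟩)
  · exact (congrFun (restrict_add_restrict_compl s fun _ => p) 0).symm

theorem disjoint_Iio_Ici (c : ℤ) : Disjoint (Set.Iio c) (Set.Ici c) :=
  Set.disjoint_left.mpr fun _ hx hx' => not_le_of_gt (Set.mem_Iio.mp hx) (Set.mem_Ici.mp hx')

/-- For `a = c - D` and `b = c - m`, the multiples `l • ξ` and `r • ξ` lie left and right of the
cut, and only `q • ξ` can straddle it. -/
theorem exists_supportedOn_Ico_add {a b : ℤ} (hab : a ≤ b) (p : Laurent) :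
    ∃ l ∈ supportedOn (Set.Iio a), ∃ q ∈ supportedOn (Set.Ico a b),
      ∃ r ∈ supportedOn (Set.Ici b), p = l + q + r := by
  obtain ⟨l, hl, p', hp', rfl⟩ := exists_supportedOn_add (Set.Iio a) p
  obtain ⟨r, hr, q, hq, rfl⟩ := exists_supportedOn_add (Set.Ici b) p'
  rw [Set.compl_Iio] at hp'
  rw [Set.compl_Ici] at hq
  refine ⟨l, hl, q, fun x hx => ⟨?_, hq hx⟩, r, hr, by ring⟩
  have h1 := (supportedOn (Set.Ici a)).sub_mem hp'
    (supportedOn_mono (Set.Ici_subset_Ici.mpr hab) hr)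
  rw [add_sub_cancel_left] at h1
  exact h1 hx

/-- The functionals `a ↦ ω(ab)` on the observables of a part of the chain. -/
def partialFunctional (ω : State) (s : Set ℤ) :
    Observable →ₗ[ℂ] Module.Dual ℂ (localAlgebra s) :=
  LinearMap.mk₂ ℂ (fun b (a : localAlgebra s) => ω.toLin (a * b))
    (fun b b' a => by rw [mul_add, map_add])
    (fun z b a => by rw [mul_smul', map_smul])
    (fun b a a' => by rw [Subalgebra.coe_add, add_mul, map_add])
    (fun z b a => by rw [Subalgebra.coe_smul, smul_mul', map_smul])

theorem partialFunctional_apply (ω : State) (s : Set ℤ) (b : Observable) (a : localAlgebra s) :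
    partialFunctional ω s b a = ω.toLin (a * b) := rfl

/-! ### Transposed multiplication operators on the dual of an algebra -/

section DualAction

variable {A : Type*} [Ring A] [Algebra ℂ A]

/-- The transpose of left multiplication. -/
def dualLeft (x : A) : Module.End ℂ (Module.Dual ℂ A) := (LinearMap.mulLeft ℂ x).dualMap

/-- The transpose of right multiplication. -/
def dualRight (x : A) : Module.End ℂ (Module.Dual ℂ A) := (LinearMap.mulRight ℂ x).dualMap

theorem dualLeft_mul (x y : A) : dualLeft x * dualLeft y = dualLeft (y * x) := by
  ext f a
  change f (y * (x * a)) = f (y * x * a)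
  rw [mul_assoc]

theorem dualRight_mul (x y : A) : dualRight x * dualRight y = dualRight (x * y) := by
  ext f a
  change f (a * x * y) = f (a * (x * y))
  rw [mul_assoc]

theorem dualLeft_mul_dualRight (x y : A) :
    dualLeft x * dualRight y = dualRight y * dualLeft x := by
  ext f a
  change f (x * a * y) = f (x * (a * y))
  rw [mul_assoc]

theorem dualLeft_one : dualLeft (1 : A) = 1 := by
  ext f a
  change f (1 * a) = f a
  rw [one_mul]

theorem dualRight_one : dualRight (1 : A) = 1 := by
  ext f a
  change f (a * 1) = f a
  rw [mul_one]

theorem dualLeft_neg (x : A) : dualLeft (-x) = -dualLeft x := by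
  ext f a
  change f (-x * a) = -f (x * a)
  rw [neg_mul, map_neg]

theorem dualRight_neg (x : A) : dualRight (-x) = -dualRight x := by
  ext f a
  change f (a * -x) = -f (a * x)
  rw [mul_neg, map_neg]

end DualAction

/-- The Schmidt rank of a state with `k` maximally entangled pairs is at least `4 ^ k`. -/
theorem four_pow_le_finrank {ω : State} {s t : Set ℤ} (hst : Disjoint s t) {k : ℕ}
    {a : LogicalQubits s k} {b : LogicalQubits t k} (hab : MaximallyEntangled ω a b)
    [FiniteDimensional ℂ ((localAlgebra t).toSubmodule.map (partialFunctional ω s))] :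
    4 ^ k ≤ Module.finrank ℂ ((localAlgebra t).toSubmodule.map (partialFunctional ω s)) := by
  classical
  let x : Fin k → localAlgebra s := fun i => ⟨a.X i, a.localized_X i⟩
  let z : Fin k → localAlgebra s := fun i => ⟨a.Z i, a.localized_Z i⟩
  have hxx : ∀ i, x i * x i = 1 := fun i => Subtype.ext (a.sq_X i)
  have hzz : ∀ i, z i * z i = 1 := fun i => Subtype.ext (a.sq_Z i)
  have hxz : ∀ i, x i * z i = -(z i * x i) := fun i => Subtype.ext (a.anticomm i)
  have cxx : ∀ i j, x i * x j = x j * x i := fun i j => Subtype.ext (a.comm_XX i j)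
  have cxz : ∀ i j, i ≠ j → x i * z j = z j * x i := fun i j h => Subtype.ext (a.comm_XZ i j h)
  -- Left and right multiplication commute, so the `k` logical qubits act as `2 * k` independent
  -- ones. This is why the bound is `4 ^ k`.
  let P : Fin k ⊕ Fin k → Module.End ℂ (Module.Dual ℂ (localAlgebra s)) :=
    Sum.elim (fun i => dualLeft (x i)) (fun i => dualRight (x i))
  let Q : Fin k ⊕ Fin k → Module.End ℂ (Module.Dual ℂ (localAlgebra s)) :=
    Sum.elim (fun i => dualLeft (z i)) (fun i => dualRight (z i))
  -- The stabilizer `u * u'` trades the factor `u` for a factor `u'` on the other side of the cut,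
  -- so the space of functionals is invariant. In `right` the stabilizer is inserted at the right
  -- end, which requires it to be hermitian.
  have left : ∀ {u u' : Observable}, LocalizedIn s u → LocalizedIn t u' → u * u = 1 →
      Stabilizes (u * u') ω → ∀ c d, LocalizedIn s c → LocalizedIn t d →
      ω.toLin (u * c * d) = ω.toLin (c * (u' * d)) := by
    intro u u' hu hu' huu hS c d hc _
    rw [← hS (u * c * d), hu.mul_comm hst hu']
    rw [show u' * u * (u * c * d) = u' * (u * u) * c * d by noncomm_ring, huu, mul_one,
      ← hc.mul_comm hst hu', mul_assoc]
  have right : ∀ {u u' : Observable}, LocalizedIn s u → LocalizedIn t u' → u * u = 1 →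
      star u = u → star u' = u' →
      Stabilizes (u * u') ω → ∀ c d, LocalizedIn s c → LocalizedIn t d →
      ω.toLin (c * u * d) = ω.toLin (c * (d * u')) := by
    intro u u' hu hu' huu hsu hsu' hS c d _ hd
    have hstar : star (u * u') = u * u' := by rw [star_mul, hsu, hsu', hu.mul_comm hst hu']
    rw [← hS.apply_mul hstar (c * u * d), mul_assoc c u d, hu.mul_comm hst hd]
    rw [show c * (d * u) * (u * u') = c * d * (u * u) * u' by noncomm_ring, huu, mul_one,
      mul_assoc]
  have hmem : ∀ {g : Module.Dual ℂ (localAlgebra s)} {d : Observable}, LocalizedIn t d →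
      (∀ c : localAlgebra s, ω.toLin (c * d) = g c) →
      g ∈ (localAlgebra t).toSubmodule.map (partialFunctional ω s) := fun {g d} hd h =>
    ⟨d, hd, LinearMap.ext h⟩
  have key := two_pow_card_le_finrank (P := P) (Q := Q) ?_ ?_ ?_ ?_ ?_ Finset.univ
    ((localAlgebra t).toSubmodule.map (partialFunctional ω s)) ?_ ?_
  · have h4 : (4 : ℕ) ^ k = 2 ^ (k + k) := by rw [← two_mul, pow_mul]; norm_num
    rw [h4]
    simpa using key
  · rintro (i | i)
    · exact (dualLeft_mul _ _).trans (by rw [hxx, dualLeft_one])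
    · exact (dualRight_mul _ _).trans (by rw [hxx, dualRight_one])
  · rintro (i | i)
    · exact (dualLeft_mul _ _).trans (by rw [hzz, dualLeft_one])
    · exact (dualRight_mul _ _).trans (by rw [hzz, dualRight_one])
  · rintro (i | i)
    · change dualLeft _ * dualLeft _ = -(dualLeft _ * dualLeft _)
      rw [dualLeft_mul, dualLeft_mul, hxz, dualLeft_neg, neg_neg]
    · change dualRight _ * dualRight _ = -(dualRight _ * dualRight _)
      rw [dualRight_mul, dualRight_mul, hxz, dualRight_neg]
  · rintro (i | i) (j | j) -
    · change dualLeft _ * dualLeft _ = dualLeft _ * dualLeft _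
      rw [dualLeft_mul, dualLeft_mul, cxx]
    · exact dualLeft_mul_dualRight _ _
    · exact (dualLeft_mul_dualRight _ _).symm
    · change dualRight _ * dualRight _ = dualRight _ * dualRight _
      rw [dualRight_mul, dualRight_mul, cxx]
  · rintro (i | i) (j | j) hij
    · change dualLeft _ * dualLeft _ = dualLeft _ * dualLeft _
      rw [dualLeft_mul, dualLeft_mul, cxz i j fun h => hij (h ▸ rfl)]
    · exact dualLeft_mul_dualRight _ _
    · exact (dualLeft_mul_dualRight _ _).symm
    · change dualRight _ * dualRight _ = dualRight _ * dualRight _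
      rw [dualRight_mul, dualRight_mul, cxz i j fun h => hij (h ▸ rfl)]
  · rw [Submodule.ne_bot_iff]
    refine ⟨_, ⟨1, (localAlgebra t).one_mem, rfl⟩, fun h0 => ?_⟩
    have h1 : ω.toLin (1 * 1) = 0 := LinearMap.congr_fun h0 1
    rw [mul_one, ω.map_one] at h1
    exact one_ne_zero h1
  · rintro (i | i) - _ ⟨d, hd, rfl⟩
    · exact ⟨hmem ((b.localized_X i).mul hd) fun c =>
          (left (a.localized_X i) (b.localized_X i) (a.sq_X i) (hab i).1 c d c.2 hd).symm,
        hmem ((b.localized_Z i).mul hd) fun c =>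
          (left (a.localized_Z i) (b.localized_Z i) (a.sq_Z i) (hab i).2 c d c.2 hd).symm⟩
    · exact ⟨hmem (LocalizedIn.mul hd (b.localized_X i)) fun c =>
          (right (a.localized_X i) (b.localized_X i) (a.sq_X i) (a.star_X i) (b.star_X i)
            (hab i).1 c d c.2 hd).symm,
        hmem (LocalizedIn.mul hd (b.localized_Z i)) fun c =>
          (right (a.localized_Z i) (b.localized_Z i) (a.sq_Z i) (a.star_Z i) (b.star_Z i)
            (hab i).2 c d c.2 hd).symm⟩

section Entanglement

variable {ω : State} {z : ℂ} {ξ : PhaseSpace} {D m : ℤ}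

/-- Up to generators localized on one side of the cut, the functionals of the right half-chain come
from products of generators that straddle the cut. -/
theorem map_partialFunctional_le (h : ω.IsDefinedBy z ξ) (hD : IsGreatest (sites ξ) D)
    (hm : IsLeast (sites ξ) m) (c : ℤ) :
    (localAlgebra (Set.Ici c)).toSubmodule.map (partialFunctional ω (Set.Iio c)) ≤
      Submodule.span ℂ (Set.range fun q : supportedOn (Set.Ico (c - D) (c - m)) =>
        partialFunctional ω (Set.Iio c) (pauli (restrict (Set.Ici c) (q.1 • ξ)))) := by
  have hmD : m ≤ D := hm.2 hD.1
  have hdisj : Disjoint (Set.Iio c) (Set.Ici c) := disjoint_Iio_Ici c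
  rintro _ ⟨b, hb, rfl⟩
  refine LocalizedIn.induction (s := Set.Ici c) (p := fun b => partialFunctional ω (Set.Iio c) b ∈ _)
    hb (by rw [map_zero]; exact Submodule.zero_mem _)
    (fun b b' h h' => by rw [map_add]; exact Submodule.add_mem _ h h') fun y η hη => ?_
  rw [map_smul]
  refine Submodule.smul_mem _ _ ?_
  rw [weyl_eq_smul_pauli, map_smul]
  refine Submodule.smul_mem _ _ ?_
  -- Either `η` is the right half of a stabilizer label, and then the one-sided parts of `p` can be
  -- removed, or its functional vanishes.
  by_cases hex : ∃ p : Laurent, restrict (Set.Ici c) (p • ξ) = η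
  · obtain ⟨p, rfl⟩ := hex
    obtain ⟨l, hl, q, hq, r, hr, rfl⟩ :=
      exists_supportedOn_Ico_add (a := c - D) (b := c - m) (by omega) p
    have hl0 : restrict (Set.Ici c) (l • ξ) = 0 := restrict_eq_zero
      (hdisj.mono_left ((sites_smul_subset_Iio_iff hD).mpr hl))
    have hrs : sites (r • ξ) ⊆ Set.Ici c := (sites_smul_subset_Ici_iff hm).mpr hr
    rw [add_smul, add_smul, map_add, map_add, hl0, zero_add, restrict_eq_self hrs,
      add_comm (restrict _ _)]
    obtain ⟨y, hy0, hy⟩ := pauli_mul_pauli (r • ξ) (restrict (Set.Ici c) (q • ξ))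
    obtain ⟨v, hv⟩ := h.cyclic_le_stabilizerLabels (mem_cyclic.mpr ⟨r, rfl⟩)
    have hv0 : v ≠ 0 := left_ne_zero_of_mul_eq_one hv.mul_self_eq_one
    -- The stabilizer with label `r • ξ` lies right of the cut, hence commutes past `a` and is
    -- absorbed by `ω`.
    have heq : (v * y) • partialFunctional ω (Set.Iio c)
        (pauli (r • ξ + restrict (Set.Ici c) (q • ξ))) =
        partialFunctional ω (Set.Iio c) (pauli (restrict (Set.Ici c) (q • ξ))) := by
      rw [← map_smul, ← smul_smul, ← hy]
      refine LinearMap.ext fun a => ?_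
      rw [partialFunctional_apply, partialFunctional_apply]
      refine Eq.trans (congrArg _ ?_) (hv _)
      rw [Observable.mul_smul', Observable.smul_mul', ← mul_assoc, ← mul_assoc,
        LocalizedIn.mul_comm hdisj a.2 (localizedIn_pauli hrs)]
    rw [(eq_inv_smul_iff₀ (mul_ne_zero hv0 hy0)).mpr heq]
    exact Submodule.smul_mem _ _ (Submodule.subset_span ⟨⟨q, hq⟩, rfl⟩)
  -- For `ζ` left of the cut, `ζ + η` in the cyclic module would exhibit `η` as a right half, so all
  -- expectations vanish.
  · have h0 : partialFunctional ω (Set.Iio c) (pauli η) = 0 := by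
      refine LinearMap.ext fun a => ?_
      rw [partialFunctional_apply, LinearMap.zero_apply]
      refine LocalizedIn.induction (p := fun a => ω.toLin (a * pauli η) = 0) a.2
        (by rw [zero_mul, map_zero]) (fun a a' h h' => by rw [add_mul, map_add, h, h', add_zero])
        fun y ζ hζ => ?_
      obtain ⟨v, -, hv⟩ := pauli_mul_pauli ζ η
      rw [weyl_eq_smul_pauli, Observable.smul_mul', Observable.smul_mul', hv, map_smul, map_smul, map_smul,
        h.apply_pauli_eq_zero, smul_zero, smul_zero, smul_zero]
      intro hmem
      obtain ⟨p, hp⟩ := mem_cyclic.mp hmem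
      refine hex ⟨p, ?_⟩
      rw [hp, map_add, restrict_eq_self hη, restrict_eq_zero (hdisj.mono_left hζ), zero_add]
    rw [h0]
    exact Submodule.zero_mem _

/-- The Schmidt rank lies between `4 ^ k` and the number `2 ^ (D - m)` of polynomials in the window.
-/
theorem two_mul_le_of_maximallyEntangled (h : ω.IsDefinedBy z ξ) (hD : IsGreatest (sites ξ) D)
    (hm : IsLeast (sites ξ) m) (c : ℤ) {k : ℕ} {a : LogicalQubits (Set.Iio c) k}
    {b : LogicalQubits (Set.Ici c) k} (hab : MaximallyEntangled ω a b) :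
    2 * k ≤ (D - m).toNat := by
  have hle := map_partialFunctional_le h hD hm c
  have hdisj : Disjoint (Set.Iio c) (Set.Ici c) := disjoint_Iio_Ici c
  have : Finite (supportedOn (Set.Ico (c - D) (c - m))) := Module.finite_of_finite (ZMod 2)
  have := Fintype.ofFinite (supportedOn (Set.Ico (c - D) (c - m)))
  have hfin := FiniteDimensional.span_of_finite ℂ
    (Set.finite_range fun q : supportedOn (Set.Ico (c - D) (c - m)) =>
        partialFunctional ω (Set.Iio c) (pauli (restrict (Set.Ici c) (q.1 • ξ))))
  have : FiniteDimensional ℂ ((localAlgebra (Set.Ici c)).toSubmodule.map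
    (partialFunctional ω (Set.Iio c))) := Submodule.finiteDimensional_of_le hle
  have h1 := four_pow_le_finrank hdisj hab
  have h2 := Submodule.finrank_mono hle
  have h3 := finrank_range_le_card (R := ℂ) fun q : supportedOn (Set.Ico (c - D) (c - m)) =>
        partialFunctional ω (Set.Iio c) (pauli (restrict (Set.Ici c) (q.1 • ξ)))
  rw [Module.card_eq_pow_finrank (K := ZMod 2), finrank_supportedOn_Ico, ZMod.card,
    sub_sub_sub_cancel_left] at h3
  have h4 : (4 : ℕ) ^ k = 2 ^ (2 * k) := by rw [pow_mul]; norm_num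
  rw [h4] at h1
  exact (Nat.pow_le_pow_iff_right (by norm_num)).mp (h1.trans (h2.trans h3))

/-! ### Entanglement of stabilizer states: lower bound -/

/-- The commutation form of the left halves of the elements of a cyclic submodule. -/
def cutForm (ξ : PhaseSpace) (c : ℤ) : Laurent →ₗ[ZMod 2] Laurent →ₗ[ZMod 2] ZMod 2 :=
  symp.compl₁₂
    (restrict (Set.Iio c) ∘ₗ (LinearMap.toSpanSingleton Laurent PhaseSpace ξ).restrictScalars _)
    (restrict (Set.Iio c) ∘ₗ (LinearMap.toSpanSingleton Laurent PhaseSpace ξ).restrictScalars _)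

theorem cutForm_apply (ξ : PhaseSpace) (c : ℤ) (p q : Laurent) :
    cutForm ξ c p q = symp (restrict (Set.Iio c) (p • ξ)) (restrict (Set.Iio c) (q • ξ)) := rfl

/-- For `p` in the radical, the left half of `p • ξ` commutes with all generators, so it is itself a
multiple `p' • ξ`. Then `p'` has exponents left of the window and `p - p'` right of it, which leaves
nothing for `p`. -/
theorem cutForm_nondegenerate (h : ω.IsDefinedBy z ξ) (hD : IsGreatest (sites ξ) D)
    (hm : IsLeast (sites ξ) m) (c : ℤ) (p : Laurent)
    (hp : p ∈ supportedOn (Set.Ico (c - D) (c - m)))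
    (h0 : ∀ q ∈ supportedOn (Set.Ico (c - D) (c - m)), cutForm ξ c p q = 0) : p = 0 := by
  have hmD : m ≤ D := hm.2 hD.1
  -- One-sided multiples pair trivially: the left half of `l • ξ` is a full stabilizer label, and
  -- that of `r • ξ` is zero.
  have hall : ∀ q, cutForm ξ c p q = 0 := fun q => by
    obtain ⟨l, hl, q, hq, r, hr, rfl⟩ :=
      exists_supportedOn_Ico_add (a := c - D) (b := c - m) (by omega) q
    have h1 : cutForm ξ c p l = 0 := by
      rw [cutForm_apply, symp_comm, ← symp_restrict_left,
        restrict_eq_self ((sites_smul_subset_Iio_iff hD).mpr hl)]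
      exact h.symp_eq_zero (mem_cyclic.mpr ⟨l, rfl⟩) (mem_cyclic.mpr ⟨p, rfl⟩)
    have h2 : cutForm ξ c p r = 0 := by
      rw [cutForm_apply, restrict_eq_zero (ξ := r • ξ) ((disjoint_Iio_Ici c).symm.mono_left
        ((sites_smul_subset_Ici_iff hm).mpr hr)), map_zero]
    rw [map_add, map_add, h1, h2, h0 q hq, add_zero, add_zero]
  have hmem : restrict (Set.Iio c) (p • ξ) ∈ cyclic ξ := h.mem_cyclic_iff.mpr fun x => by
    rw [symp_comm, symp_restrict_left]
    exact hall _
  obtain ⟨p', hp'⟩ := mem_cyclic.mp hmem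
  have h1 : supp p' ⊆ Set.Iio (c - D) := (sites_smul_subset_Iio_iff hD).mp
    (hp' ▸ sites_restrict_subset _ _)
  have h2 : supp (p - p') ⊆ Set.Ici (c - m) := (sites_smul_subset_Ici_iff hm).mp (by
    have : restrict (Set.Iio c)ᶜ (p • ξ) = (p - p') • ξ := by
      rw [sub_smul, hp', eq_sub_iff_add_eq', restrict_add_restrict_compl]
    rw [← this, Set.compl_Iio]
    exact sites_restrict_subset _ _)
  ext x
  by_contra hx
  have hxW := hp hx
  have e1 : p'.coeff x = 0 := by
    by_contra h'
    exact absurd (h1 h') (not_lt.mpr hxW.1)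
  have e2 : (p - p').coeff x = 0 := by
    by_contra h'
    exact absurd (h2 h') (not_le.mpr hxW.2)
  apply hx
  rwa [AddMonoidAlgebra.coeff_sub, Finsupp.sub_apply, e1, sub_zero] at e2

/-- Logical qubits whose logical Pauli operators are Pauli products. -/
def pauliQubits {s : Set ℤ} {k : ℕ} (e f : Fin k → PhaseSpace) (x z : Fin k → ℂ)
    (he : ∀ i, sites (e i) ⊆ s) (hf : ∀ i, sites (f i) ⊆ s) (hx : ∀ i, x i * x i = 1)
    (hz : ∀ i, z i * z i = 1) (hee : ∀ i j, symp (e i) (e j) = 0)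
    (hff : ∀ i j, symp (f i) (f j) = 0) (hef : ∀ i, symp (e i) (f i) = 1)
    (hne : ∀ i j, i ≠ j → symp (e i) (f j) = 0) : LogicalQubits s k where
  X i := x i • pauli (e i)
  Z i := z i • pauli (f i)
  localized_X i := (localizedIn_pauli (he i)).smul _
  localized_Z i := (localizedIn_pauli (hf i)).smul _
  star_X i := by rw [star_smul', star_pauli, star_eq_self_of_mul_self (hx i)]
  star_Z i := by rw [star_smul', star_pauli, star_eq_self_of_mul_self (hz i)]
  sq_X i := by rw [smul_mul', mul_smul', pauli_mul_self, smul_smul, hx, one_smul]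
  sq_Z i := by rw [smul_mul', mul_smul', pauli_mul_self, smul_smul, hz, one_smul]
  anticomm i := by
    simp only [smul_mul', mul_smul', pauli_anticommute (hef i), smul_neg, smul_smul]
    rw [mul_comm]
  comm_XX i j := by
    simp only [smul_mul', mul_smul', pauli_commute (hee i j), smul_smul]
    rw [mul_comm]
  comm_ZZ i j := by
    simp only [smul_mul', mul_smul', pauli_commute (hff i j), smul_smul]
    rw [mul_comm]
  comm_XZ i j h := by
    simp only [smul_mul', mul_smul', pauli_commute (hne i j h), smul_smul]
    rw [mul_comm]

/-- The two halves of a stabilizer Pauli product, with a suitable sign, multiply to a stabilizer. -/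
theorem exists_stabilizes_restrict {η : PhaseSpace} (s : Set ℤ) (hη : η ∈ stabilizerLabels ω) :
    ∃ x : ℂ, x * x = 1 ∧
      Stabilizes ((1 : ℂ) • pauli (restrict s η) * x • pauli (restrict sᶜ η)) ω := by
  obtain ⟨v, hv⟩ := hη
  obtain ⟨y, hy0, hy⟩ := pauli_mul_pauli (restrict s η) (restrict sᶜ η)
  rw [restrict_add_restrict_compl] at hy
  have hc := pauli_commute (symp_eq_zero_of_disjoint
    (disjoint_compl_right.mono (sites_restrict_subset s η) (sites_restrict_subset sᶜ η)))
  -- The halves are commuting involutions, so their product is an involution too.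
  have hyy : y * y = 1 := mul_self_eq_one_of_smul_pauli (ξ := η) (by
    rw [← hy]
    nth_rewrite 2 [hc]
    rw [mul_assoc, ← mul_assoc (pauli (restrict sᶜ η)), pauli_mul_self, one_mul, pauli_mul_self])
  refine ⟨v * y, ?_, ?_⟩
  · linear_combination (y * y) * hv.mul_self_eq_one + hyy
  · rw [one_smul, mul_smul', hy, smul_smul, mul_assoc, hyy, mul_one]
    exact hv

/-- A symplectic basis of the window supplies the logical operators as left and right halves of
stabilizers. The right halves obey the same relations because whole stabilizers commute; the sign of
each stabilizer is assigned to its right half. -/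
theorem exists_maximallyEntangled (h : ω.IsDefinedBy z ξ) (hD : IsGreatest (sites ξ) D)
    (hm : IsLeast (sites ξ) m) (c : ℤ) :
    ∃ (k : ℕ) (a : LogicalQubits (Set.Iio c) k) (b : LogicalQubits (Set.Ici c) k),
      (D - m).toNat ≤ 2 * k ∧ MaximallyEntangled ω a b := by
  obtain ⟨k, e, f, hk, hmem, hee, hff, hef, hne⟩ := exists_hyperbolic_pairs (cutForm ξ c)
    (fun _ => symp_self _) (fun _ _ => symp_comm _ _) _
    (supportedOn (Set.Ico (c - D) (c - m))) le_rfl (cutForm_nondegenerate h hD hm c)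
  rw [finrank_supportedOn_Ico, sub_sub_sub_cancel_left] at hk
  have hcyc : ∀ p : Laurent, p • ξ ∈ cyclic ξ := fun p => mem_cyclic.mpr ⟨p, rfl⟩
  have hright : ∀ p q, symp (restrict (Set.Ici c) (p • ξ)) (restrict (Set.Ici c) (q • ξ)) =
      cutForm ξ c p q := fun p q => by
    have := symp_eq_add_restrict (Set.Iio c) (p • ξ) (q • ξ)
    rw [h.symp_eq_zero (hcyc p) (hcyc q), Set.compl_Iio] at this
    exact (CharTwo.add_eq_zero.mp this.symm).symm
  choose x hx hxs using fun p : Laurent => exists_stabilizes_restrict (Set.Iio c)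
    (h.cyclic_le_stabilizerLabels (hcyc p))
  rw [Set.compl_Iio] at hxs
  refine ⟨k,
    pauliQubits (fun i => restrict (Set.Iio c) (e i • ξ)) (fun i => restrict (Set.Iio c) (f i • ξ))
      (fun _ => 1) (fun _ => 1) (fun _ => sites_restrict_subset _ _)
      (fun _ => sites_restrict_subset _ _) (fun _ => one_mul 1) (fun _ => one_mul 1)
      hee hff hef hne,
    pauliQubits (fun i => restrict (Set.Ici c) (e i • ξ)) (fun i => restrict (Set.Ici c) (f i • ξ))
      (fun i => x (e i)) (fun i => x (f i)) (fun _ => sites_restrict_subset _ _)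
      (fun _ => sites_restrict_subset _ _) (fun i => hx _) (fun i => hx _)
      (fun i j => (hright _ _).trans (hee i j)) (fun i j => (hright _ _).trans (hff i j))
      (fun i => (hright _ _).trans (hef i)) (fun i j hij => (hright _ _).trans (hne i j hij)),
    hk, fun i => ⟨hxs (e i), hxs (f i)⟩⟩

/-- The entanglement of a pure translation-invariant stabilizer state is half the width of its
generator. -/
theorem exists_entanglement_eq (h : ω.IsDefinedBy z ξ) (hD : IsGreatest (sites ξ) D)
    (hm : IsLeast (sites ξ) m) (c : ℤ) :
    ∃ k : ℕ, entanglement ω c = k ∧ 2 * (k : ℤ) = D - m := by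
  obtain ⟨k, a, b, hk, hab⟩ := exists_maximallyEntangled h hD hm c
  have hk' := two_mul_le_of_maximallyEntangled h hD hm c hab
  have hmD : m ≤ D := hm.2 hD.1
  -- The two bounds coincide for this `k`, which also shows that the width is even.
  refine ⟨k, le_antisymm (sSup_le ?_) (le_sSup ⟨k, rfl, a, b, hab⟩), by omega⟩
  rintro _ ⟨k', rfl, a', b', hab'⟩
  have := two_mul_le_of_maximallyEntangled h hD hm c hab'
  exact Nat.cast_le.mpr (by omega)

end Entanglement


/-! ### The action of an automaton on labels -/

theorem translate_weyl (x : ℤ) (ξ : PhaseSpace) : translate x (weyl ξ) = weyl (shift x ξ) :=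
  Finsupp.mapDomain_single

theorem sgn_injective : Function.Injective sgn := by
  intro a b h
  rcases zmod_two_eq a with rfl | rfl <;> rcases zmod_two_eq b with rfl | rfl
  · rfl
  · rw [sgn_zero, sgn_one] at h; norm_num at h
  · rw [sgn_zero, sgn_one] at h; norm_num at h
  · rfl

theorem smul_weyl_injective {ξ : PhaseSpace} {z z' : ℂ} (h : z • weyl ξ = z' • weyl ξ) :
    z = z' := by
  classical
  simpa [coeff_smul, coeff_weyl] using congrArg (fun a => coeff a ξ) h

namespace CQCA

variable (T : CQCA)

theorem label_add (ξ η : PhaseSpace) : T.label (ξ + η) = T.label ξ + T.label η := by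
  obtain ⟨y, -, hy⟩ := T.label_spec ξ
  obtain ⟨y', -, hy'⟩ := T.label_spec η
  have h : weyl (ξ + η) = sgn (dot (ξ 1) (η 0)) • (weyl ξ * weyl η) := by
    rw [weyl_mul_weyl, smul_smul, sgn_mul_self, one_smul]
  refine (T.label_unique _ _ (sgn (dot (ξ 1) (η 0)) *
    (y * (y' * sgn (dot (T.label ξ 1) (T.label η 0))))) ?_).symm
  rw [h, map_smul, map_mul, hy, hy', Observable.smul_mul', Observable.mul_smul', weyl_mul_weyl,
    smul_smul, smul_smul, smul_smul]
  congr 1; ring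

theorem label_shift (x : ℤ) (ξ : PhaseSpace) : T.label (shift x ξ) = shift x (T.label ξ) := by
  obtain ⟨y, -, hy⟩ := T.label_spec ξ
  refine (T.label_unique _ _ y ?_).symm
  rw [← translate_weyl, T.translate_comm, hy, map_smul, translate_weyl]

theorem label_zero : T.label 0 = 0 := by
  have := T.label_add 0 0
  rwa [add_zero, left_eq_add] at this

theorem label_smul (p : Laurent) (ξ : PhaseSpace) : T.label (p • ξ) = p • T.label ξ := by
  induction p using AddMonoidAlgebra.induction_linear with
  | zero => rw [zero_smul, zero_smul, label_zero]
  | add p q hp hq => rw [add_smul, add_smul, label_add, hp, hq]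
  | single x a =>
    rcases zmod_two_eq a with rfl | rfl
    · rw [AddMonoidAlgebra.single_zero, zero_smul, zero_smul, label_zero]
    · exact T.label_shift x ξ

theorem label_apply (ξ : PhaseSpace) (i : Fin 2) :
    T.label ξ i = T.matrix i 0 * ξ 0 + T.matrix i 1 * ξ 1 := by
  have h : ξ = ξ 0 • Pi.single 0 1 + ξ 1 • Pi.single 1 1 := by
    ext j : 1
    fin_cases j <;> simp
  conv_lhs => rw [h]
  rw [label_add, label_smul, label_smul, Pi.add_apply, Pi.smul_apply, Pi.smul_apply, smul_eq_mul,
    smul_eq_mul, mul_comm, mul_comm (ξ 1)]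
  rfl

/-- An automorphism preserves the commutation sign of two Pauli products. -/
theorem symp_label (ξ η : PhaseSpace) : symp (T.label ξ) (T.label η) = symp ξ η := by
  obtain ⟨y, hy1, hy⟩ := T.label_spec ξ
  obtain ⟨y', hy1', hy'⟩ := T.label_spec η
  have hy0 : y ≠ 0 := by rintro rfl; simp at hy1
  have hy0' : y' ≠ 0 := by rintro rfl; simp at hy1'
  have h := congrArg T.toEquiv (weyl_comm ξ η)
  rw [map_smul, map_mul, map_mul, hy, hy'] at h
  simp only [Observable.smul_mul', Observable.mul_smul'] at h
  rw [weyl_comm (T.label ξ), weyl_mul_weyl] at h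
  simp only [smul_smul] at h
  have h1 := smul_weyl_injective h
  have h2 : y * y' * sgn (dot (T.label η 1) (T.label ξ 0)) ≠ 0 :=
    mul_ne_zero (mul_ne_zero hy0 hy0') (sgn_ne_zero _)
  refine sgn_injective (mul_left_cancel₀ h2 ?_)
  linear_combination h1

theorem form_label (ξ η : PhaseSpace) : form (T.label ξ) (T.label η) = form ξ η := by
  ext x
  rw [← symp_shift_left, ← symp_shift_left, ← label_shift, symp_label]

/-- The form of the images of `X₀` and `Z₀` is still `1`; reflection invariance removes the
inversions in it, and modulo two the result is the determinant. -/
theorem IsCentered.det_eq_one {T : CQCA} (hT : T.IsCentered) :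
    T.matrix 0 0 * T.matrix 1 1 + T.matrix 1 0 * T.matrix 0 1 = 1 := by
  have h := T.form_label (Pi.single 0 1) (Pi.single 1 1)
  have h1 : form (Pi.single 0 1) (Pi.single 1 1) = 1 := by simp [form]
  rw [h1, form] at h
  change LaurentPolynomial.invert (T.matrix 1 0) * T.matrix 0 1 +
    LaurentPolynomial.invert (T.matrix 0 0) * T.matrix 1 1 = 1 at h
  rw [hT, hT] at h
  rw [← h, add_comm]

/-- The Cayley-Hamilton theorem. -/
theorem IsCentered.label_label {T : CQCA} (hT : T.IsCentered) (ξ : PhaseSpace) :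
    T.label (T.label ξ) = T.matrix.trace • T.label ξ + ξ := by
  -- The vanishing of `2` absorbs all signs in the Cayley-Hamilton identity; `hdet` turns its
  -- determinant term into `ξ`.
  have h2 : (2 : Laurent) = 0 := by
    rw [← one_add_one_eq_two]; exact laurent_add_self 1
  have hdet := hT.det_eq_one
  ext i : 1
  rw [Matrix.trace_fin_two, Pi.add_apply, Pi.smul_apply, smul_eq_mul, label_apply, label_apply,
    label_apply, label_apply]
  fin_cases i
  · simp only [Fin.zero_eta]
    linear_combination (ξ 0) * hdet - (ξ 0 * T.matrix 0 0 * T.matrix 1 1) * h2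
  · simp only [Fin.mk_one]
    linear_combination (ξ 1) * hdet - (ξ 1 * T.matrix 0 0 * T.matrix 1 1) * h2

theorem IsCentered.reflect_label {T : CQCA} (hT : T.IsCentered) (ξ : PhaseSpace) :
    reflect (T.label ξ) = T.label (reflect ξ) := by
  ext i : 1
  rw [reflect, label_apply, label_apply, map_add, map_mul, map_mul, hT, hT]
  rfl

/-! ### The evolution of stabilizer states -/

/-- The pullback of a state along an automaton. -/
def pullback (φ : State) : State where
  toLin := φ.toLin ∘ₗ T.toEquiv.toAlgEquiv.toLinearMap
  nonneg a := by
    change 0 ≤ φ.toLin (T.toEquiv (star a * a))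
    rw [map_mul, StarHomClass.map_star]
    exact φ.nonneg _
  map_one := by
    change φ.toLin (T.toEquiv 1) = 1
    rw [_root_.map_one]
    exact φ.map_one

/-- Uniqueness is transported backwards: a state with the new stabilizers pulls back along `T` to
one with the old stabilizers. -/
theorem exists_isDefinedBy_step {ω : State} {z : ℂ} {ξ : PhaseSpace} (h : ω.IsDefinedBy z ξ) :
    ∃ z', (T.step ω).IsDefinedBy z' (T.label ξ) := by
  obtain ⟨y, -, hy⟩ := T.label_spec ξ
  have key : ∀ x, T.toEquiv (z • weyl (shift x ξ)) = (z * y) • weyl (shift x (T.label ξ)) :=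
    fun x => by
      rw [map_smul, ← translate_weyl, T.translate_comm, hy, map_smul, translate_weyl, smul_smul]
  refine ⟨z * y, ?_, fun φ hφ => ?_⟩
  · rintro S ⟨x, rfl⟩
    rw [← key]
    exact T.stabilizes_step ω _ (h.1 _ ⟨x, rfl⟩)
  · have h1 : T.pullback φ = ω := h.2 _ fun S hS a => by
      obtain ⟨x, rfl⟩ := hS
      change φ.toLin (T.toEquiv _) = φ.toLin (T.toEquiv a)
      rw [map_mul, key]
      exact hφ _ ⟨x, rfl⟩ _
    refine ext_toLin fun a => ?_
    rw [← h1]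
    change _ = φ.toLin (T.toEquiv (T.toEquiv.symm a))
    rw [StarAlgEquiv.apply_symm_apply]

theorem exists_isDefinedBy_evolve {ω : State} {z : ℂ} {ξ : PhaseSpace} (h : ω.IsDefinedBy z ξ)
    (t : ℕ) : ∃ z', (T.evolve t ω).IsDefinedBy z' (T.label^[t] ξ) := by
  induction t with
  | zero => exact ⟨z, h⟩
  | succ t ih =>
    obtain ⟨z', h'⟩ := ih
    rw [evolve, Function.iterate_succ_apply', Function.iterate_succ_apply']
    exact T.exists_isDefinedBy_step h'

end CQCA

/-! ### Degrees -/

theorem deg_eq_of_isGreatest {p : Laurent} {d : ℤ} (hd : IsGreatest (supp p) d) : deg p = d := by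
  have : LaurentPolynomial.degree p = d := by
    refine le_antisymm (Finset.max_le fun x hx => ?_)
      (Finset.le_max (Finsupp.mem_support_iff.mpr hd.1))
    exact WithBot.coe_le_coe.mpr (hd.2 (Finsupp.mem_support_iff.mp hx))
  rw [deg, this]
  rfl

theorem deg_zero : deg 0 = 0 := by
  rw [deg, LaurentPolynomial.degree_zero]; rfl

theorem isGreatest_deg {p : Laurent} (hp : p ≠ 0) : IsGreatest (supp p) (deg p) := by
  obtain ⟨d, hd⟩ := exists_isGreatest (supp_finite p) (supp_nonempty hp)
  rwa [deg_eq_of_isGreatest hd]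

theorem le_deg {p : Laurent} {x : ℤ} (hx : x ∈ supp p) : x ≤ deg p := by
  have hp : p ≠ 0 := by rintro rfl; simp [supp_zero] at hx
  exact (isGreatest_deg hp).2 hx

theorem deg_nonneg_of_invert_eq {p : Laurent} (h : LaurentPolynomial.invert p = p) :
    0 ≤ deg p := by
  rcases eq_or_ne p 0 with rfl | hp
  · rw [deg_zero]
  have h1 : -deg p ∈ supp p := by
    rw [mem_supp, ← LaurentPolynomial.invert_apply, h]
    exact (isGreatest_deg hp).1
  have := le_deg h1
  omega

/-! ### Asymptotics -/

/-- A sequence bounded below that behaves like the degrees of a solution of `f'' = τ f' + f`, where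
`τ` has degree `d`, grows linearly with rate `d`. -/
theorem exists_abs_sub_le {D : ℕ → ℤ} {d b : ℤ} (hd : 0 ≤ d) (hb : ∀ n, b ≤ D n)
    (hle : ∀ n, D (n + 2) ≤ max (D (n + 1) + d) (D n))
    (heq : 0 < d → ∀ n, D n < D (n + 1) + d → D (n + 2) = D (n + 1) + d) :
    ∃ (C : ℤ) (N : ℕ), ∀ n ≥ N, |D n - n * d| ≤ C := by
  rcases hd.eq_or_lt with rfl | hd
  -- For `d = 0` the maximum of two consecutive terms never increases.
  · have h1 : ∀ n, D n ≤ max (D 0) (D 1) ∧ D (n + 1) ≤ max (D 0) (D 1) := by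
      intro n
      induction n with
      | zero => exact ⟨le_max_left _ _, le_max_right _ _⟩
      | succ n ih =>
        refine ⟨ih.2, (hle n).trans ?_⟩
        rw [add_zero]
        exact max_le ih.2 ih.1
    refine ⟨|max (D 0) (D 1)| + |b|, 0, fun n _ => ?_⟩
    have h2 := (h1 n).1
    have h3 := hb n
    rw [mul_zero, sub_zero, abs_le]
    have h4 := le_abs_self (max (D 0) (D 1))
    have h5 := neg_abs_le b
    have h6 := abs_nonneg (max (D 0) (D 1))
    have h7 := abs_nonneg b
    constructor <;> omega
  -- Otherwise every step would lower `D` by at least `d ≥ 1`, and `D` would fall below `b`.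
  · obtain ⟨N, hN⟩ : ∃ N, D N < D (N + 1) + d := by
      by_contra! h
      have h1 : ∀ n : ℕ, D n ≤ D 0 - n := by
        intro n
        induction n with
        | zero => simp
        | succ n ih => have := h n; push_cast; omega
      have h2 := h1 (D 0 - b + 1).toNat
      have h3 := hb (D 0 - b + 1).toNat
      have h4 := hb 0
      omega
    -- Once the strict inequality holds it persists, since the next increment is exactly `d > 0`.
    have h1 : ∀ j : ℕ, D (N + j) < D (N + j + 1) + d ∧ D (N + j + 1) = D (N + 1) + j * d := by
      intro j
      induction j with
      | zero => exact ⟨hN, by simp⟩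
      | succ j ih =>
        have h2 := heq hd _ ih.1
        refine ⟨?_, ?_⟩
        · rw [← add_assoc, h2]; omega
        · rw [← add_assoc, h2, ih.2]; push_cast; ring
    refine ⟨|D (N + 1) - (N + 1) * d|, N + 1, fun n hn => ?_⟩
    obtain ⟨j, rfl⟩ := Nat.exists_eq_add_of_le hn
    have h2 := (h1 j).2
    rw [show N + 1 + j = N + j + 1 by ring, h2]
    apply le_of_eq
    congr 1
    push_cast; ring

theorem tendsto_inv_mul_of_abs_sub_le {f : ℕ → ℝ} {d C : ℝ} {N : ℕ}
    (h : ∀ n ≥ N, |f n - n * d| ≤ C) :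
    Filter.Tendsto (fun n : ℕ => (1 / (n : ℝ)) * f n) Filter.atTop (nhds d) := by
  rw [tendsto_iff_dist_tendsto_zero]
  refine squeeze_zero' (Filter.Eventually.of_forall fun _ => dist_nonneg) ?_
    (tendsto_const_div_atTop_nhds_zero_nat C)
  filter_upwards [Filter.eventually_ge_atTop N, Filter.eventually_gt_atTop 0] with n hn hn0
  have hn' : (0 : ℝ) < n := Nat.cast_pos.mpr hn0
  have h1 : 1 / (n : ℝ) * f n - d = (f n - n * d) / n := by field_simp
  rw [Real.dist_eq, h1, abs_div, abs_of_pos hn']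
  exact div_le_div_of_nonneg_right (h n hn) hn'.le

/-- The widths of the labels of the evolved generators grow with twice the degree of the trace. -/
theorem exists_abs_width_sub_le {T : CQCA} (hT : T.IsCentered) {ξ : PhaseSpace} {D m : ℕ → ℤ}
    (hξ : reflect ξ ∈ cyclic ξ) (hD : ∀ t, IsGreatest (sites (T.label^[t] ξ)) (D t))
    (hm : ∀ t, IsLeast (sites (T.label^[t] ξ)) (m t)) :
    ∃ (C : ℤ) (N : ℕ), ∀ t ≥ N, |D t - m t - 2 * (t * deg T.matrix.trace)| ≤ C := by
  obtain ⟨p, hp⟩ := mem_cyclic.mp hξ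
  -- The map on labels is Laurent-linear and commutes with reflection, so `p` does not depend on
  -- time.
  have hreflect : ∀ t, p • T.label^[t] ξ = reflect (T.label^[t] ξ) := by
    intro t
    induction t with
    | zero => exact hp
    | succ t ih => rw [Function.iterate_succ_apply', hT.reflect_label, ← ih, T.label_smul]
  have hp0 : p ≠ 0 := by
    rintro rfl
    have h1 := (isGreatest_sites_reflect (hm 0)).1
    rw [← hreflect, zero_smul] at h1
    exact notMem_sites.mpr (fun _ => rfl) h1
  have hwidth : ∀ t, D t - m t = 2 * D t + deg p := fun t => by
    have h1 := isGreatest_sites_smul (isGreatest_deg hp0) (hD t)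
    rw [hreflect] at h1
    have := h1.unique (isGreatest_sites_reflect (hm t))
    omega
  have hrec : ∀ t, T.label^[t + 2] ξ =
      T.matrix.trace • T.label^[t + 1] ξ + T.label^[t] ξ := fun t => by
    rw [Function.iterate_succ_apply', Function.iterate_succ_apply', hT.label_label]
  have hsymm : LaurentPolynomial.invert T.matrix.trace = T.matrix.trace := by
    rw [Matrix.trace_fin_two, map_add, hT, hT]
  -- The width `2 * D t + deg p` is nonnegative.
  have hlow : ∀ t, -|deg p| ≤ D t := fun t => by
    have h1 := hwidth t
    have h2 := (hm t).2 (hD t).1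
    have h3 := le_abs_self (deg p)
    have h4 := abs_nonneg (deg p)
    omega
  have hle : ∀ t, D (t + 2) ≤ max (D (t + 1) + deg T.matrix.trace) (D t) := fun t => by
    have h1 := (hD (t + 2)).1
    rw [hrec] at h1
    refine sites_add_subset (s := Set.Iic _) (fun x hx => ?_) (fun x hx => ?_) h1
    · obtain ⟨a, ha, b, hb, rfl⟩ := exists_add_of_mem_sites_smul hx
      have h2 := le_deg ha
      have h3 := (hD (t + 1)).2 hb
      exact (show a + b ≤ D (t + 1) + deg T.matrix.trace by omega).trans (le_max_left _ _)
    · exact le_max_of_le_right ((hD t).2 hx)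
  -- The top site of the trace term lies strictly beyond all sites of the other term, so it cannot
  -- cancel.
  have heq : 0 < deg T.matrix.trace → ∀ t, D t < D (t + 1) + deg T.matrix.trace →
      D (t + 2) = D (t + 1) + deg T.matrix.trace := fun hpos t ht => by
    have h0 : T.matrix.trace ≠ 0 := fun h0 => by
      rw [h0, deg_zero] at hpos
      exact lt_irrefl _ hpos
    have h1 := isGreatest_sites_smul (isGreatest_deg h0) (hD (t + 1))
    have h2 := isGreatest_sites_add h1 (η := T.label^[t] ξ) fun x hx =>
      ((hD t).2 hx).trans_lt (by omega)
    rw [← hrec] at h2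
    rw [(hD (t + 2)).unique h2, add_comm]
  obtain ⟨C, N, h⟩ := exists_abs_sub_le (deg_nonneg_of_invert_eq hsymm) hlow hle heq
  refine ⟨2 * C + |deg p|, N, fun t ht => ?_⟩
  have h1 := abs_le.mp (h t ht)
  have h2 := le_abs_self (deg p)
  have h3 := neg_abs_le (deg p)
  rw [hwidth, abs_le]
  generalize (t : ℤ) * deg T.matrix.trace = r at h1
  constructor <;> omega

end CliffordQCA
end

/-! ### The entanglement generation rate -/

theorem mainTheorem1 (T : CliffordQCA.CQCA) (hT : T.IsCentered) (ω : CliffordQCA.State)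
    (hω : ω.IsPureTIStabilizerState) (c : ℤ) :
    (∀ t : ℕ, CliffordQCA.entanglement (T.evolve t ω) c ≠ ⊤) ∧
      Filter.Tendsto
        (fun t : ℕ => (1 / (t : ℝ)) * ((CliffordQCA.entanglement (T.evolve t ω) c).toNat : ℝ))
        Filter.atTop (nhds (CliffordQCA.deg T.matrix.trace : ℝ)) := by
  obtain ⟨-, z, ξ, -, hstab, huniq⟩ := hω
  have h : ω.IsDefinedBy z ξ := ⟨hstab, huniq⟩
  choose z' h' using T.exists_isDefinedBy_evolve h
  choose D hD using fun t => CliffordQCA.exists_isGreatest (CliffordQCA.sites_finite _)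
    (CliffordQCA.sites_nonempty (h' t).label_ne_zero)
  choose m hm using fun t => CliffordQCA.exists_isLeast (CliffordQCA.sites_finite _)
    (CliffordQCA.sites_nonempty (h' t).label_ne_zero)
  choose k hk hkw using fun t => CliffordQCA.exists_entanglement_eq (h' t) (hD t) (hm t) c
  refine ⟨fun t => by rw [hk]; exact ENat.natCast_ne_top _, ?_⟩
  obtain ⟨C, N, hC⟩ := CliffordQCA.exists_abs_width_sub_le hT h.reflect_mem_cyclic hD hm
  refine CliffordQCA.tendsto_inv_mul_of_abs_sub_le (C := C) (N := N) fun t ht => ?_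
  rw [hk, ENat.toNat_natCast]
  have h1 := hC t ht
  -- The width is `2 * k t`, so the width bound is a bound on twice this difference.
  have h2 : |(k t : ℤ) - t * CliffordQCA.deg T.matrix.trace| ≤ C := by
    rw [← hkw t, ← mul_sub, abs_mul, abs_two] at h1
    have := abs_nonneg ((k t : ℤ) - t * CliffordQCA.deg T.matrix.trace)
    omega
  exact_mod_cast h2
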